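/- **Theorem.** Weak Vopěnka's Principle and Semi-Weak Vopěnka's Principle are equivalent over $\mathrm{GB}+\mathrm{AC}$, Gödel–Bernays set theory with the Axiom of Choice for sets. That is, in every model $(V,\in,\mathcal X)$ of $\mathrm{GB}+\mathrm{AC}$ (with sets $V$, classes $\mathcal X\subseteq\mathcal P(V)$, and comprehension for formulas that quantify only over sets and may have set and class parameters), WVP holds if and only if SWVP holds. Here a *graph* is a set $G$ together with an arbitrary binary relation $E$ on $G$, and a *homomorphism* $\langle G,E\rangle\to\langle G',E'\rangle$ is a function $h:G\to G'$ such that $\langle v,w\rangle\in E$ implies $\langle h(v),h(w)\rangle\in E'$. * *Weak Vopěnka's Principle* (WVP) says that there is no sequence (class function) of graphs $\langle G_\alpha:\alpha\in\mathrm{Ord}\rangle$ such that whenever $\alpha\le\alpha'$ there is a unique homomorphism $G_{\alpha'}\to G_\alpha$, and whenever $\alpha<\alpha'$ there is no homomorphism $G_\alpha\to G_{\alpha'}$. * *Semi-Weak Vopěnka's Principle* (SWVP) says that there is no sequence (class function) of graphs $\langle G_\alpha:\alpha\in\mathrm{Ord}\rangle$ such that whenever $\alpha\le\alpha'$ there is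 a (not necessarily unique) homomorphism $G_{\alpha'}\to G_\alpha$, and whenever $\alpha<\alpha'$ there is no homomorphism $G_\alpha\to G_{\alpha'}$. -/

import Mathlib

/-- A structure for second-order set theory in the usual presentation `(V, ∈, 𝒳)`: a type `V` of
sets with a membership relation, and a family `𝒳` of subcollections of `V`, the classes.
Nothing is assumed about well-foundedness or standardness of the membership relation, and `𝒳` need
not contain every subcollection of `V`. -/
structure SecondOrderStructure (V : Type*) where
  /-- `mem x y` says that the set `x` is a member of the set `y`. -/
  mem : V → V → Prop
  /-- The family of classes. -/
  classes : Set (Set V)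

namespace SecondOrderStructure

/-- The relation symbols of the first-order language of `(V, ∈, A)_{A ∈ 𝒳}`: a binary symbol for
membership and a unary symbol for every class. -/
inductive RelSymbol {V : Type*} (S : SecondOrderStructure V) : ℕ → Type _
  | mem : RelSymbol S 2
  | cls (A : S.classes) : RelSymbol S 1

/-- The first-order language with membership and a predicate for every class. -/
def language {V : Type*} (S : SecondOrderStructure V) : FirstOrder.Language where
  Functions := fun _ => Empty
  Relations := S.RelSymbol

instance structureInst {V : Type*} (S : SecondOrderStructure V) : S.language.Structure V where
  funMap := fun f _ => f.elim
  RelMap := fun {_} r =>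
    match r with
    | .mem => fun v => S.mem (v 0) (v 1)
    | .cls A => fun v => v 0 ∈ A.1

section Basic

variable {V : Type*} (S : SecondOrderStructure V)

/-- `p` is the Kuratowski ordered pair `{{x}, {x, y}}`. -/
def IsPair (x y p : V) : Prop :=
  ∀ z, S.mem z p ↔ (∀ w, S.mem w z ↔ w = x) ∨ (∀ w, S.mem w z ↔ w = x ∨ w = y)

/-- The set `r` (viewed as a relation) contains the ordered pair of `x` and `y`. -/
def SetRel (r x y : V) : Prop := ∃ p, S.mem p r ∧ S.IsPair x y p

/-- The class `R` (viewed as a relation) contains the ordered pair of `x` and `y`. -/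
def ClassRel (R : Set V) (x y : V) : Prop := ∃ p ∈ R, S.IsPair x y p

/-- The set `h` is a function from the set `a` to the set `b`. -/
def IsFunction (h a b : V) : Prop :=
  (∀ p, S.mem p h → ∃ x y, S.mem x a ∧ S.mem y b ∧ S.IsPair x y p) ∧
  ∀ x, S.mem x a → ∃! y, S.SetRel h x y

/-- `f` is a choice function on the set `a`: a function with domain `a` such that `f(x) ∈ x` for
all `x ∈ a`. -/
def IsChoiceFunction (f a : V) : Prop :=
  (∃ b, S.IsFunction f a b) ∧ ∀ x y, S.SetRel f x y → S.mem y x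

/-- `a` is a (von Neumann) ordinal: a transitive set that is linearly ordered by membership. Its
members are well-ordered by membership because of the axiom of foundation. -/
def IsOrdinal (a : V) : Prop :=
  (∀ x y, S.mem x y → S.mem y a → S.mem x a) ∧
  ∀ x y, S.mem x a → S.mem y a → S.mem x y ∨ x = y ∨ S.mem y x

/-- The axioms of Gödel–Bernays set theory together with the axiom of choice for sets. -/
structure ModelsGBAC : Prop where
  /-- Extensionality for sets; for classes it holds by construction. -/
  extensionality : ∀ x y, (∀ z, S.mem z x ↔ S.mem z y) → x = y
  pairing : ∀ x y, ∃ a, ∀ z, S.mem z a ↔ z = x ∨ z = y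
  union : ∀ x, ∃ a, ∀ z, S.mem z a ↔ ∃ y, S.mem z y ∧ S.mem y x
  powerset : ∀ x, ∃ a, ∀ z, S.mem z a ↔ ∀ w, S.mem w z → S.mem w x
  /-- There is a set that contains the empty set and is closed under `x ↦ x ∪ {x}`. -/
  infinity : ∃ a, (∃ x, S.mem x a ∧ ∀ z, ¬ S.mem z x) ∧
    ∀ x, S.mem x a → ∃ y, S.mem y a ∧ ∀ z, S.mem z y ↔ S.mem z x ∨ z = x
  /-- Every nonempty class has a member disjoint from it. -/
  foundation : ∀ A ∈ S.classes, A.Nonempty → ∃ x ∈ A, ∀ z, S.mem z x → z ∉ A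
  /-- Predicative comprehension: every collection of sets that is defined by a first-order formula
  (so with quantifiers over sets only), with sets and classes as parameters, is a class. -/
  comprehension : ∀ A : Set V, (Set.univ : Set V).Definable₁ S.language A → A ∈ S.classes
  /-- The image of a set under a (possibly partial) class function is a set. -/
  replacement : ∀ F ∈ S.classes,
    (∀ x y z, S.ClassRel F x y → S.ClassRel F x z → y = z) →
    ∀ a, ∃ b, ∀ y, S.mem y b ↔ ∃ x, S.mem x a ∧ S.ClassRel F x y
  /-- Every set of nonempty sets has a choice function, which is a set. -/
  choice : ∀ a, (∀ x, S.mem x a → ∃ z, S.mem z x) → ∃ f, S.IsChoiceFunction f a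

/-- `G` is the graph `⟨v, e⟩`: the ordered pair of a set `v` and a binary relation `e` on `v`. -/
def IsGraphOn (G v e : V) : Prop :=
  S.IsPair v e G ∧ ∀ p, S.mem p e → ∃ x y, S.mem x v ∧ S.mem y v ∧ S.IsPair x y p

/-- `G` is a graph: a set equipped with an arbitrary binary relation. -/
def IsGraph (G : V) : Prop := ∃ v e, S.IsGraphOn G v e

/-- `h` is a homomorphism from the graph `G` to the graph `H`. -/
def IsHom (G H h : V) : Prop :=
  ∃ v e w f, S.IsGraphOn G v e ∧ S.IsGraphOn H w f ∧ S.IsFunction h v w ∧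
    ∀ x y x₁ y₁, S.SetRel e x y → S.SetRel h x x₁ → S.SetRel h y y₁ → S.SetRel f x₁ y₁

/-- The class `F` is a sequence of graphs `⟨G_α : α ∈ Ord⟩`, that is, a class function from the
class of all ordinals to graphs. -/
def IsOrdSequenceOfGraphs (F : Set V) : Prop :=
  F ∈ S.classes ∧
  (∀ p ∈ F, ∃ α G, S.IsOrdinal α ∧ S.IsGraph G ∧ S.IsPair α G p) ∧
  ∀ α, S.IsOrdinal α → ∃! G, S.ClassRel F α G

/-- Weak Vopěnka's Principle: there is no sequence of graphs `⟨G_α : α ∈ Ord⟩` such that there is a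
unique homomorphism `G_β → G_α` whenever `α ≤ β`, and no homomorphism `G_α → G_β` whenever
`α < β`. -/
def WeakVopenkaPrinciple : Prop :=
  ¬ ∃ F : Set V, S.IsOrdSequenceOfGraphs F ∧
    (∀ α β, S.IsOrdinal α → S.IsOrdinal β → S.mem α β ∨ α = β →
      ∀ Gα Gβ, S.ClassRel F α Gα → S.ClassRel F β Gβ → ∃! h, S.IsHom Gβ Gα h) ∧
    (∀ α β, S.IsOrdinal α → S.IsOrdinal β → S.mem α β →
      ∀ Gα Gβ, S.ClassRel F α Gα → S.ClassRel F β Gβ → ¬ ∃ h, S.IsHom Gα Gβ h)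

/-- Semi-Weak Vopěnka's Principle: there is no sequence of graphs `⟨G_α : α ∈ Ord⟩` such that there
is a homomorphism `G_β → G_α`, not necessarily unique, whenever `α ≤ β`, and no homomorphism
`G_α → G_β` whenever `α < β`. -/
def SemiWeakVopenkaPrinciple : Prop :=
  ¬ ∃ F : Set V, S.IsOrdSequenceOfGraphs F ∧
    (∀ α β, S.IsOrdinal α → S.IsOrdinal β → S.mem α β ∨ α = β →
      ∀ Gα Gβ, S.ClassRel F α Gα → S.ClassRel F β Gβ → ∃ h, S.IsHom Gβ Gα h) ∧
    (∀ α β, S.IsOrdinal α → S.IsOrdinal β → S.mem α β →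
      ∀ Gα Gβ, S.ClassRel F α Gα → S.ClassRel F β Gβ → ¬ ∃ h, S.IsHom Gα Gβ h)

end Basic

end SecondOrderStructure

-- A counterexample to WVP is one to SWVP, so the content is the converse: from graphs `gr ξ` with
-- homomorphisms downwards and none upwards, a sequence with unique homomorphisms downwards and none
-- upwards must be built.
--
-- For an ordinal α let β be the least ordinal above α closed under successors and under ξ ↦ rank of
-- `gr ξ`. The new graph of index α codes a structure with two kinds of objects: points, the members
-- of V_β ∪ {β}, and branches, the functions f of length at most β with f(ξ) a vertex of `gr (ξ +
-- 1)`. They are tied together by membership and non-membership between points, by "length of f =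
-- rank of x", by membership of points in branches, and by coordinatewise edges between branches.
-- The top point β acts as a wild card, so for β ≤ γ collapsing everything outside V_β to β and
-- restricting branches to β respects all relations (`isPointMap_trunc`).
--
-- The structure is rigid because no map can raise the rank κ of a point (`IsPointMap.not_rank_lt`).
-- If it did, branches of length κ would go to branches having a coordinate κ. Choose homomorphisms
-- H_ξ from `gr κ` to `gr (ξ + 1)` for ξ < κ; sending v to the branch (H_ξ v), mapping it and
-- reading off coordinate κ gives a homomorphism from `gr κ` to `gr (κ + 1)`, which does not exist.
-- Induction on rank, using both membership and non-membership, then forces the map on points to be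
-- the truncation (`IsPointMap.eq_trunc`), and that on branches to be the restriction
-- (`IsPointMap.eq_restr`). A map from closed point γ to a larger β would send γ both to γ and to β;
-- indices sharing a closed point are separated by an extra edge depending on α
-- (`isHom_rigidGraph`).
--
-- One binary relation suffices because vertices come in sorts, recognised through five marker
-- vertices. As comprehension is predicative, every class and function used has to be first-order
-- definable with parameters; choice is needed only for a set of homomorphism sets.

universe u

set_option linter.unusedSectionVars false

namespace SecondOrderStructure

/-! ### Definability with set and class parameters -/

section

variable {V : Type u} (S : SecondOrderStructure V)

/-- A predicate on tuples of sets that is first-order definable with set and class parameters. -/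
class DefPred {n : ℕ} (P : (Fin n → V) → Prop) : Prop where
  out : (Set.univ : Set V).Definable S.language {v | P v}

/-- A function on tuples of sets whose graph is definable. -/
class DefFun {n : ℕ} (t : (Fin n → V) → V) : Prop where
  out : S.DefPred fun w : Fin (n + 1) → V => w (Fin.last n) = t fun i => w i.castSucc

/-- The collection `A` is a class. -/
class IsClass (A : Set V) : Prop where
  out : A ∈ S.classes

variable {S} {n : ℕ}

namespace DefPred

variable {P Q : (Fin n → V) → Prop}

instance and [hP : S.DefPred P] [hQ : S.DefPred Q] : S.DefPred fun v => P v ∧ Q v :=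
  ⟨hP.out.inter hQ.out⟩

instance or [hP : S.DefPred P] [hQ : S.DefPred Q] : S.DefPred fun v => P v ∨ Q v :=
  ⟨hP.out.union hQ.out⟩

instance not [hP : S.DefPred P] : S.DefPred fun v => ¬ P v :=
  ⟨hP.out.compl⟩

theorem of_iff (hP : S.DefPred P) (h : ∀ v, Q v ↔ P v) : S.DefPred Q := by
  have : Q = P := funext fun v => propext (h v)
  rwa [this]

instance imp [hP : S.DefPred P] [hQ : S.DefPred Q] : S.DefPred fun v => P v → Q v :=
  of_iff (P := fun v => ¬ P v ∨ Q v) inferInstance fun _ => imp_iff_not_or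

instance iff [hP : S.DefPred P] [hQ : S.DefPred Q] : S.DefPred fun v => P v ↔ Q v :=
  of_iff (P := fun v => (P v → Q v) ∧ (Q v → P v)) inferInstance fun _ => iff_iff_implies_and_implies

/-- Quantification is projection along the last coordinate. `Q` is curried so that a formula can be
treated one quantifier at a time, each adding one variable. -/
instance ex {Q : (Fin n → V) → V → Prop}
    [h : S.DefPred fun w : Fin (n + 1) → V => Q (fun i => w i.castSucc) (w (Fin.last n))] :
    S.DefPred fun v => ∃ x, Q v x := by
  constructor
  convert h.out.image_comp (Fin.castSucc : Fin n → Fin (n + 1)) using 1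
  ext v
  simp only [Set.mem_ofPred_eq, Set.mem_image]
  constructor
  · rintro ⟨x, hx⟩
    refine ⟨Fin.snoc v x, ?_, ?_⟩
    · simpa using hx
    · ext i; simp
  · rintro ⟨w, hw, rfl⟩
    exact ⟨_, hw⟩

instance all {Q : (Fin n → V) → V → Prop}
    [h : S.DefPred fun w : Fin (n + 1) → V => Q (fun i => w i.castSucc) (w (Fin.last n))] :
    S.DefPred fun v => ∀ x, Q v x :=
  of_iff (P := fun v => ¬ ∃ x, ¬ Q v x) inferInstance fun _ => by simp

instance const (p : Prop) : S.DefPred fun _ : Fin n → V => p := by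
  by_cases h : p
  · exact ⟨by simp [h]⟩
  · exact ⟨by simp [h]⟩

/-- The index type is finite in the metatheory, so this is a finite disjunction and not a quantifier
over sets. -/
instance exFinite {ι : Type} [Finite ι] {Q : ι → (Fin n → V) → Prop} [h : ∀ i, S.DefPred (Q i)] :
    S.DefPred fun v => ∃ i, Q i v := by
  constructor
  convert Set.definable_iUnion_of_finite (f := fun i => {v | Q i v}) (fun i => (h i).out) using 1
  ext; simp

end DefPred

open FirstOrder Language in
theorem defPred_mem_proj (i j : Fin n) : S.DefPred fun v => S.mem (v i) (v j) := by
  constructor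
  refine Set.Definable.mono (A := ∅) ?_ (Set.empty_subset _)
  rw [Set.empty_definable_iff]
  refine ⟨Relations.formula₂ (L := S.language) (RelSymbol.mem : S.RelSymbol 2)
    (Term.var i) (Term.var j), ?_⟩
  ext v
  simp
  rfl

open FirstOrder Language in
theorem defPred_cls_proj (A : Set V) [hA : S.IsClass A] (i : Fin n) :
    S.DefPred fun v => v i ∈ A := by
  constructor
  refine Set.Definable.mono (A := ∅) ?_ (Set.empty_subset _)
  rw [Set.empty_definable_iff]
  refine ⟨Relations.formula₁ (L := S.language) (RelSymbol.cls ⟨A, hA.out⟩ : S.RelSymbol 1)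
    (Term.var i), ?_⟩
  ext v
  simp
  rfl

open FirstOrder Language in
theorem defPred_eq_proj (i j : Fin n) : S.DefPred fun v => v i = v j := by
  constructor
  refine Set.Definable.mono (A := ∅) ?_ (Set.empty_subset _)
  rw [Set.empty_definable_iff]
  refine ⟨Term.equal (L := S.language) (Term.var i) (Term.var j), ?_⟩
  ext v
  simp

open FirstOrder Language in
theorem defPred_eq_const (i : Fin n) (c : V) : S.DefPred fun v => v i = c := by
  constructor
  refine ⟨Term.equal (Term.var i)
    (Constants.term (S.language.con (⟨c, trivial⟩ : (Set.univ : Set V)))), ?_⟩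
  ext v
  simp

instance DefFun.proj (i : Fin n) : S.DefFun fun v => v i :=
  ⟨defPred_eq_proj _ _⟩

instance DefFun.const (c : V) : S.DefFun fun _ : Fin n → V => c :=
  ⟨defPred_eq_const _ _⟩

/-- The language has no terms for the `t i`, so `P (t v)` is read as: some tuple y satisfies P and
lies on the graphs of all `t i` at v. The coordinates of y are then projected away. -/
theorem DefPred.subst {k : ℕ} {P : (Fin k → V) → Prop} (hP : S.DefPred P)
    (t : Fin k → (Fin n → V) → V) (ht : ∀ i, S.DefFun (t i)) :
    S.DefPred fun v => P fun i => t i v := by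
  constructor
  have h1 : (Set.univ : Set V).Definable S.language
      {w : Fin n ⊕ Fin k → V | P fun i => w (Sum.inr i)} :=
    hP.out.preimage_comp Sum.inr
  have h2 (i : Fin k) : (Set.univ : Set V).Definable S.language
      {w : Fin n ⊕ Fin k → V | w (Sum.inr i) = t i fun j => w (Sum.inl j)} := by
    convert (ht i).out.out.preimage_comp
      (Fin.lastCases (Sum.inr i) Sum.inl : Fin (n + 1) → Fin n ⊕ Fin k) using 1
    ext w
    simp [Function.comp_def]
  have h3 := Set.definable_iInter_of_finite h2
  convert (h1.inter h3).image_comp (Sum.inl : Fin n → Fin n ⊕ Fin k) using 1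
  ext v
  simp only [Set.mem_ofPred_eq, Set.mem_image, Set.mem_inter_iff, Set.mem_iInter]
  constructor
  · intro h
    exact ⟨Sum.elim v fun i => t i v, ⟨by simpa using h, fun i => by simp⟩, by ext; simp⟩
  · rintro ⟨w, ⟨hw, hw'⟩, rfl⟩
    convert hw using 2 with i
    exact (hw' i).symm

theorem DefFun.subst {k : ℕ} {f : (Fin k → V) → V} (hf : S.DefFun f)
    (t : Fin k → (Fin n → V) → V) (ht : ∀ i, S.DefFun (t i)) :
    S.DefFun fun v => f fun i => t i v := by
  constructor
  have ht' (i : Fin k) : S.DefFun fun w : Fin (n + 1) → V => t i fun j => w j.castSucc := by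
    constructor
    constructor
    convert (ht i).out.out.preimage_comp
      (Fin.lastCases (Fin.last _) (fun i => i.castSucc.castSucc) : Fin (n + 1) → Fin (n + 2)) using 1
    ext w
    simp [Function.comp_def]
  have := hf.out.subst
    (Fin.lastCases (fun w : Fin (n + 1) → V => w (Fin.last n)) (fun i w => t i fun j => w j.castSucc))
    (Fin.lastCases (by simp only [Fin.lastCases_last]; infer_instance)
      (by simpa only [Fin.lastCases_castSucc] using ht'))
  simpa using this

section Composition

variable {t t₁ t₂ t₃ : (Fin n → V) → V} [h : S.DefFun t] [h₁ : S.DefFun t₁] [h₂ : S.DefFun t₂]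
  [h₃ : S.DefFun t₃]

theorem DefPred.comp₁ {P : V → Prop} (hP : S.DefPred fun v : Fin 1 → V => P (v 0)) :
    S.DefPred fun v => P (t v) :=
  hP.subst ![t] (by simpa using h)

theorem DefPred.comp₂ {P : V → V → Prop} (hP : S.DefPred fun v : Fin 2 → V => P (v 0) (v 1)) :
    S.DefPred fun v => P (t₁ v) (t₂ v) :=
  hP.subst ![t₁, t₂] (by simp [Fin.forall_fin_succ, h₁, h₂])

theorem DefPred.comp₃ {P : V → V → V → Prop}
    (hP : S.DefPred fun v : Fin 3 → V => P (v 0) (v 1) (v 2)) :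
    S.DefPred fun v => P (t₁ v) (t₂ v) (t₃ v) :=
  hP.subst ![t₁, t₂, t₃] (by simp [Fin.forall_fin_succ, h₁, h₂, h₃])

theorem DefFun.comp₁ {f : V → V} (hf : S.DefFun fun v : Fin 1 → V => f (v 0)) :
    S.DefFun fun v => f (t v) :=
  hf.subst ![t] (by simpa using h)

theorem DefFun.comp₂ {f : V → V → V} (hf : S.DefFun fun v : Fin 2 → V => f (v 0) (v 1)) :
    S.DefFun fun v => f (t₁ v) (t₂ v) :=
  hf.subst ![t₁, t₂] (by simp [Fin.forall_fin_succ, h₁, h₂])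

instance DefPred.mem : S.DefPred fun v => S.mem (t₁ v) (t₂ v) :=
  comp₂ (defPred_mem_proj 0 1)

instance DefPred.eq : S.DefPred fun v => t₁ v = t₂ v :=
  comp₂ (P := fun x y => x = y) (defPred_eq_proj 0 1)

instance DefPred.memClass (A : Set V) [S.IsClass A] : S.DefPred fun v => t v ∈ A :=
  comp₁ (P := fun x => x ∈ A) (defPred_cls_proj A 0)

instance DefPred.isPair : S.DefPred fun v => S.IsPair (t₁ v) (t₂ v) (t₃ v) :=
  comp₃ (P := S.IsPair) (by unfold IsPair; infer_instance)

instance DefPred.setRel : S.DefPred fun v => S.SetRel (t₁ v) (t₂ v) (t₃ v) :=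
  comp₃ (P := S.SetRel) (by unfold SetRel; infer_instance)

instance DefPred.classRel (F : Set V) [S.IsClass F] :
    S.DefPred fun v => S.ClassRel F (t₁ v) (t₂ v) :=
  comp₂ (P := S.ClassRel F) (by unfold ClassRel; infer_instance)

instance DefPred.isFunction : S.DefPred fun v => S.IsFunction (t₁ v) (t₂ v) (t₃ v) :=
  comp₃ (P := S.IsFunction) (by unfold IsFunction ExistsUnique; infer_instance)

instance DefPred.isOrdinal : S.DefPred fun v => S.IsOrdinal (t v) :=
  comp₁ (P := S.IsOrdinal) (by unfold IsOrdinal; infer_instance)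

instance DefPred.isGraphOn : S.DefPred fun v => S.IsGraphOn (t₁ v) (t₂ v) (t₃ v) :=
  comp₃ (P := S.IsGraphOn) (by unfold IsGraphOn; infer_instance)

instance DefPred.isHom : S.DefPred fun v => S.IsHom (t₁ v) (t₂ v) (t₃ v) :=
  comp₃ (P := S.IsHom) (by unfold IsHom; infer_instance)

end Composition

end

/-! ### Sets, pairs and replacement for definable relations -/

section
variable {V : Type u} (S : SecondOrderStructure V)

/-- The members of the collection form a set. -/
def Small (P : V → Prop) : Prop := ∃ a, ∀ z, S.mem z a ↔ P z

open Classical in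
/-- The set of all `z` with `P z`, with a fixed junk value if there is no such set. -/
noncomputable def collect [Nonempty V] (P : V → Prop) : V :=
  if h : S.Small P then h.choose else Classical.arbitrary V

/-- The Kuratowski pair as a function. -/
noncomputable def pair [Nonempty V] (x y : V) : V :=
  S.collect fun z => (∀ w, S.mem w z ↔ w = x) ∨ ∀ w, S.mem w z ↔ w = x ∨ w = y

variable {S} {n : ℕ} [Nonempty V]

theorem mem_collect {P : V → Prop} (h : S.Small P) {z : V} : S.mem z (S.collect P) ↔ P z := by
  rw [collect, dif_pos h]
  exact h.choose_spec z

theorem small_mem (a : V) : S.Small fun z => S.mem z a := ⟨a, fun _ => Iff.rfl⟩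

theorem Small.congr {P Q : V → Prop} (hP : S.Small P) (h : ∀ x, Q x ↔ P x) : S.Small Q := by
  have : Q = P := funext fun x => propext (h x)
  rwa [this]

variable [hS : Fact S.ModelsGBAC]

theorem ext {x y : V} (h : ∀ z, S.mem z x ↔ S.mem z y) : x = y :=
  hS.out.extensionality x y h

theorem isClass_setOf {P : V → Prop} (h : S.DefPred fun v : Fin 1 → V => P (v 0)) :
    S.IsClass {x | P x} :=
  ⟨hS.out.comprehension _ h.out⟩

theorem collect_mem (a : V) : S.collect (fun z => S.mem z a) = a :=
  ext fun _ => mem_collect (small_mem a)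

/-- The graph splits into two definable cases: the value has exactly the required members, or no set
has them and the value is the junk set, which is a parameter. -/
instance DefFun.collect {P : (Fin n → V) → V → Prop}
    [h : S.DefPred fun w : Fin (n + 1) → V => P (fun i => w i.castSucc) (w (Fin.last n))] :
    S.DefFun fun v => S.collect (P v) := by
  constructor
  have hP {m : ℕ} {t : (Fin m → V) → V} {e : Fin n → Fin m} [ht : S.DefFun t] :
      S.DefPred fun w => P (fun i => w (e i)) (t w) := by
    have := h.subst (Fin.lastCases t fun i w => w (e i)) (Fin.lastCases
      (by simpa only [Fin.lastCases_last])
      fun i => by simp only [Fin.lastCases_castSucc]; infer_instance)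
    simpa only [Fin.lastCases_last, Fin.lastCases_castSucc] using this
  have h' : S.DefPred fun w : Fin (n + 1) → V =>
      ((∀ z, S.mem z (w (Fin.last n)) ↔ P (fun i => w i.castSucc) z) ∨
      (¬ ∃ a, ∀ z, S.mem z a ↔ P (fun i => w i.castSucc) z) ∧
        w (Fin.last n) = Classical.arbitrary V) := by
    have h₁ := hP (m := n + 1 + 1) (t := fun w => w (Fin.last _)) (e := fun i => i.castSucc.castSucc)
    have h₂ := hP (m := n + 1 + 1 + 1) (t := fun w => w (Fin.last _))
      (e := fun i => i.castSucc.castSucc.castSucc)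
    infer_instance
  refine h'.of_iff fun w => ?_
  by_cases hs : S.Small (P fun i => w i.castSucc)
  · constructor
    · intro h
      left
      intro z
      rw [h, mem_collect hs]
    · rintro (h | ⟨h, -⟩)
      · exact ext fun z => by rw [h, mem_collect hs]
      · exact absurd hs h
  · rw [SecondOrderStructure.collect, dif_neg hs]
    constructor
    · exact fun h => Or.inr ⟨hs, h⟩
    · rintro (h | ⟨-, h⟩)
      · exact absurd ⟨_, h⟩ hs
      · exact h

theorem small_doubleton (x y : V) : S.Small fun z => z = x ∨ z = y :=
  hS.out.pairing x y

theorem small_singleton (x : V) : S.Small fun z => z = x :=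
  (small_doubleton x x).congr fun _ => by simp

theorem isPair_pair (x y : V) : S.IsPair x y (S.pair x y) := by
  obtain ⟨a, ha⟩ := small_singleton (S := S) x
  obtain ⟨b, hb⟩ := small_doubleton (S := S) x y
  intro z
  refine mem_collect ((small_doubleton a b).congr fun z => or_congr ⟨fun h => ?_, ?_⟩ ⟨fun h => ?_, ?_⟩)
  · exact ext fun w => (h w).trans (ha w).symm
  · rintro rfl; exact ha
  · exact ext fun w => (h w).trans (hb w).symm
  · rintro rfl; exact hb

theorem isPair_iff {x y p : V} : S.IsPair x y p ↔ p = S.pair x y := by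
  constructor
  · exact fun h => ext fun z => (h z).trans (isPair_pair x y z).symm
  · rintro rfl; exact isPair_pair x y

theorem setRel_iff {r x y : V} : S.SetRel r x y ↔ S.mem (S.pair x y) r := by
  simp [SetRel, isPair_iff]

theorem classRel_iff {F : Set V} {x y : V} : S.ClassRel F x y ↔ S.pair x y ∈ F := by
  simp [ClassRel, isPair_iff]

theorem pair_inj {x y x' y' : V} : S.pair x y = S.pair x' y' ↔ x = x' ∧ y = y' := by
  refine ⟨fun h => ?_, by rintro ⟨rfl, rfl⟩; rfl⟩
  obtain ⟨a, ha⟩ := small_singleton (S := S) x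
  obtain ⟨b, hb⟩ := small_doubleton (S := S) x y
  obtain ⟨a', ha'⟩ := small_singleton (S := S) x'
  obtain ⟨b', hb'⟩ := small_doubleton (S := S) x' y'
  have h1 := isPair_pair (S := S) x y
  have h2 := isPair_pair (S := S) x' y'
  rw [← h] at h2
  have e z := (h1 z).symm.trans (h2 z)
  have ea := (e a).1 (Or.inl ha)
  have eb := (e b).1 (Or.inr hb)
  have ea' := (e a').2 (Or.inl ha')
  have eb' := (e b').2 (Or.inr hb')
  simp only [ha, hb, ha', hb'] at ea eb ea' eb'
  have hx : x = x' := by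
    rcases ea with h | h
    · exact (h x).1 rfl
    · exact ((h x').2 (Or.inl rfl)).symm
  subst hx
  refine ⟨rfl, ?_⟩
  rcases eb with h | h
  · have hy := (h y).1 (Or.inr rfl)
    rcases eb' with h' | h'
    · exact hy.trans ((h' y').1 (Or.inr rfl)).symm
    · rcases (h' y').1 (Or.inr rfl) with h'' | h''
      · exact hy.trans h''.symm
      · exact h''.symm
  · rcases (h y).1 (Or.inr rfl) with h'' | h''
    · rcases (h y').2 (Or.inr rfl) with h' | h'
      · exact h''.trans h'.symm
      · exact h'.symm
    · exact h''

instance DefFun.pair {t u : (Fin n → V) → V} [S.DefFun t] [S.DefFun u] :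
    S.DefFun fun v => S.pair (t v) (u v) :=
  comp₂ (f := S.pair) (by unfold SecondOrderStructure.pair; infer_instance)

theorem Small.image {P : V → Prop} (hP : S.Small P) (R : V → V → Prop)
    [hR : S.DefPred fun v : Fin 2 → V => R (v 0) (v 1)]
    (hf : ∀ x y z, R x y → R x z → y = z) : S.Small fun y => ∃ x, P x ∧ R x y := by
  obtain ⟨a, ha⟩ := hP
  have {n} {t u : (Fin n → V) → V} [S.DefFun t] [S.DefFun u] : S.DefPred fun v => R (t v) (u v) :=
    hR.comp₂
  have hc : S.IsClass {p | ∃ x y, R x y ∧ p = S.pair x y} :=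
    isClass_setOf (P := fun p => ∃ x y, R x y ∧ p = S.pair x y) inferInstance
  have key (x y : V) : S.ClassRel {p | ∃ x y, R x y ∧ p = S.pair x y} x y ↔ R x y := by
    rw [classRel_iff]
    constructor
    · rintro ⟨x', y', h, e⟩
      obtain ⟨rfl, rfl⟩ := pair_inj.1 e
      exact h
    · exact fun h => ⟨x, y, h, rfl⟩
  obtain ⟨b, hb⟩ := hS.out.replacement _ hc.out
    (fun x y z h h' => hf x y z ((key _ _).1 h) ((key _ _).1 h')) a
  exact ⟨b, fun z => by simp [hb, key, ha]⟩

theorem Small.imageFun {P : V → Prop} (hP : S.Small P) (f : V → V)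
    [hf : S.DefFun fun v : Fin 1 → V => f (v 0)] : S.Small fun y => ∃ x, P x ∧ y = f x := by
  have {n} {t : (Fin n → V) → V} [S.DefFun t] : S.DefFun fun v => f (t v) := DefFun.comp₁ hf
  exact hP.image (fun x y => y = f x) fun x y z h h' => h.trans h'.symm

theorem Small.mono {P Q : V → Prop} (hQ : S.Small Q) [hP : S.DefPred fun v : Fin 1 → V => P (v 0)]
    (h : ∀ x, P x → Q x) : S.Small P := by
  have {n} {t : (Fin n → V) → V} [S.DefFun t] : S.DefPred fun v => P (t v) := hP.comp₁
  refine (hQ.image (fun x y => P x ∧ x = y) fun x y z h h' => h.2.symm.trans h'.2).congr fun x => ?_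
  constructor
  · exact fun hx => ⟨x, h x hx, hx, rfl⟩
  · rintro ⟨x, -, hx, rfl⟩; exact hx

theorem Small.biUnion {P : V → Prop} (hP : S.Small P) (Q : V → V → Prop)
    [hQ : S.DefPred fun v : Fin 2 → V => Q (v 0) (v 1)] (hs : ∀ x, P x → S.Small (Q x)) :
    S.Small fun z => ∃ x, P x ∧ Q x z := by
  have {n} {t u : (Fin n → V) → V} [S.DefFun t] [S.DefFun u] : S.DefPred fun v => Q (t v) (u v) :=
    hQ.comp₂
  obtain ⟨a, ha⟩ := hP.imageFun (fun x => S.collect (Q x))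
  obtain ⟨b, hb⟩ := hS.out.union a
  refine ⟨b, fun z => ?_⟩
  simp only [hb, ha]
  constructor
  · rintro ⟨y, hz, x, hx, rfl⟩
    exact ⟨x, hx, (mem_collect (hs x hx)).1 hz⟩
  · rintro ⟨x, hx, hz⟩
    exact ⟨_, (mem_collect (hs x hx)).2 hz, x, hx, rfl⟩

theorem Small.or {P Q : V → Prop} (hP : S.Small P) (hQ : S.Small Q) :
    S.Small fun z => P z ∨ Q z := by
  obtain ⟨a, ha⟩ := hP
  obtain ⟨b, hb⟩ := hQ
  exact ((small_doubleton a b).biUnion (fun x z => S.mem z x) fun x _ => small_mem x).congr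
    fun z => by simp [ha, hb]

theorem small_subset (x : V) : S.Small fun z => ∀ w, S.mem w z → S.mem w x :=
  hS.out.powerset x

theorem Small.subset {P : V → Prop} (hP : S.Small P) :
    S.Small fun z => ∀ w, S.mem w z → P w := by
  obtain ⟨a, ha⟩ := hP
  exact (small_subset a).congr fun z => by simp [ha]

theorem Small.prod {P Q : V → Prop} (hP : S.Small P) (hQ : S.Small Q)
    [h : S.DefPred fun v : Fin 1 → V => Q (v 0)] :
    S.Small fun p => ∃ x, P x ∧ ∃ y, Q y ∧ p = S.pair x y := by
  have {n} {t : (Fin n → V) → V} [S.DefFun t] : S.DefPred fun v => Q (t v) := h.comp₁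
  exact hP.biUnion (fun x p => ∃ y, Q y ∧ p = S.pair x y) fun x _ => hQ.imageFun (S.pair x)

/-- Membership need not be well-founded externally; foundation applies only to classes, so the
counterexamples have to be definable. -/
theorem mem_induction {P : V → Prop} [h : S.DefPred fun v : Fin 1 → V => P (v 0)]
    (ih : ∀ x, (∀ y, S.mem y x → P y) → P x) (x : V) : P x := by
  by_contra hx
  have hc : S.IsClass {x | ¬ P x} := isClass_setOf (P := fun x => ¬ P x) inferInstance
  obtain ⟨y, hy, hy'⟩ := hS.out.foundation _ hc.out ⟨x, hx⟩
  exact hy (ih y fun z hz => not_not.1 (hy' z hz))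

theorem mem_irrefl (x : V) : ¬ S.mem x x :=
  mem_induction (P := fun x => ¬ S.mem x x) (fun x ih h => ih x h h) x

theorem mem_asymm {x y : V} (h : S.mem x y) : ¬ S.mem y x :=
  mem_induction (P := fun x => ∀ y, S.mem x y → ¬ S.mem y x)
    (fun x ih y h h' => ih y h' x h' h) x y h

end

/-! ### Ordinals -/

section
variable {V : Type u} (S : SecondOrderStructure V)

/-- The successor `a ∪ {a}`. -/
noncomputable def succ [Nonempty V] (a : V) : V := S.collect fun z => S.mem z a ∨ z = a

/-- The section `{x | (η, x) ∈ r}` of a set relation. -/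
noncomputable def sect [Nonempty V] (r η : V) : V := S.collect fun x => S.SetRel r η x

/-- The relation `r` codes the first `θ` stages of the recursion `R α = ⋃_{ξ < α} Φ (R ξ)`. -/
def IsStage [Nonempty V] (Φ : V → V) (r θ : V) : Prop :=
  ∀ ξ, S.mem ξ θ → ∀ x, S.SetRel r ξ x ↔ ∃ η, S.mem η ξ ∧ S.mem x (Φ (S.sect r η))

/-- The solution of the recursion `R α = ⋃_{ξ < α} Φ (R ξ)` on the ordinals. -/
noncomputable def recUnion [Nonempty V] (Φ : V → V) (η : V) : V :=
  S.collect fun x => ∃ r θ, S.IsOrdinal θ ∧ S.IsStage Φ r θ ∧ S.mem η θ ∧ S.SetRel r η x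

/-- The power set. -/
noncomputable def powerset [Nonempty V] (x : V) : V :=
  S.collect fun z => ∀ w, S.mem w z → S.mem w x

/-- The level `V_α` of the cumulative hierarchy. -/
noncomputable def level [Nonempty V] (α : V) : V := S.recUnion S.powerset α

/-- The rank of a set. -/
noncomputable def rank [Nonempty V] (x : V) : V :=
  S.collect fun ξ => S.IsOrdinal ξ ∧ ¬ ∀ y, S.mem y x → S.mem y (S.level ξ)

/-- `β` is closed under successors. -/
def SuccClosed [Nonempty V] (β : V) : Prop := ∀ ξ, S.mem ξ β → S.mem (S.succ ξ) β

variable {S} {n : ℕ} [Nonempty V] [hS : Fact S.ModelsGBAC]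

theorem mem_asymm₃ {x y z : V} (h : S.mem x y) (h' : S.mem y z) : ¬ S.mem z x :=
  mem_induction (S := S) (P := fun x => ∀ y z, S.mem x y → S.mem y z → ¬ S.mem z x)
    (fun x ih y z hxy hyz hzx => ih z hzx x y hzx hxy hyz) x y z h h'

theorem exists_minimal {P : V → Prop} (hP : S.DefPred fun v : Fin 1 → V => P (v 0))
    (h : ∃ x, P x) : ∃ x, P x ∧ ∀ y, S.mem y x → ¬ P y :=
  hS.out.foundation _ (isClass_setOf hP).out h

namespace IsOrdinal

variable {a b c x y : V}

theorem trans (ha : S.IsOrdinal a) (h : S.mem x y) (h' : S.mem y a) : S.mem x a :=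
  ha.1 x y h h'

theorem of_mem (ha : S.IsOrdinal a) (hb : S.mem b a) : S.IsOrdinal b := by
  refine ⟨fun x y hxy hyb => ?_, fun x y hx hy => ha.2 x y (ha.trans hx hb) (ha.trans hy hb)⟩
  have hya := ha.trans hyb hb
  rcases ha.2 x b (ha.trans hxy hya) hb with h | rfl | h
  · exact h
  · exact absurd hyb (mem_asymm hxy)
  · exact absurd h (mem_asymm₃ hxy hyb)

/-- A minimal element of a \ b has exactly the members of b. -/
theorem mem_of_ssubset (ha : S.IsOrdinal a) (hb : S.IsOrdinal b)
    (h : ∀ z, S.mem z b → S.mem z a) (hne : b ≠ a) : S.mem b a := by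
  have : ∃ x, S.mem x a ∧ ¬ S.mem x b := by
    by_contra! hc
    exact hne (ext fun z => ⟨h z, hc z⟩)
  obtain ⟨x, ⟨hxa, hxb⟩, hmin⟩ := exists_minimal (S := S) (P := fun x => S.mem x a ∧ ¬ S.mem x b)
    inferInstance this
  suffices b = x by rwa [this]
  refine ext (S := S) fun z => ⟨fun hz => ?_, fun hz => ?_⟩
  · rcases ha.2 z x (h z hz) hxa with h' | rfl | h'
    · exact h'
    · exact absurd hz hxb
    · exact absurd (hb.trans h' hz) hxb
  · by_contra hzb
    exact hmin z hz ⟨ha.trans hz hxa, hzb⟩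

/-- If a ∩ b were different from both a and b, it would be a member of both, hence of itself. -/
theorem trichotomy (ha : S.IsOrdinal a) (hb : S.IsOrdinal b) :
    S.mem a b ∨ a = b ∨ S.mem b a := by
  obtain ⟨c, hc⟩ : S.Small fun z => S.mem z a ∧ S.mem z b := (small_mem a).mono fun x h => h.1
  have hco : S.IsOrdinal c := by
    refine ⟨fun x y hx hy => ?_, fun x y hx hy => ?_⟩
    · simp only [hc] at hy ⊢
      exact ⟨ha.trans hx hy.1, hb.trans hx hy.2⟩
    · simp only [hc] at hx hy
      exact ha.2 x y hx.1 hy.1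
  by_cases h1 : c = a
  · subst h1
    by_cases h2 : c = b
    · exact Or.inr (Or.inl h2)
    · exact Or.inl (hb.mem_of_ssubset hco (fun z hz => ((hc z).1 hz).2) h2)
  · by_cases h2 : c = b
    · subst h2
      exact Or.inr (Or.inr (ha.mem_of_ssubset hco (fun z hz => ((hc z).1 hz).1) h1))
    · exact absurd ((hc c).2 ⟨ha.mem_of_ssubset hco (fun z hz => ((hc z).1 hz).1) h1,
        hb.mem_of_ssubset hco (fun z hz => ((hc z).1 hz).2) h2⟩) (mem_irrefl c)

theorem not_mem (ha : S.IsOrdinal a) (hb : S.IsOrdinal b) (h : ¬ S.mem a b) :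
    S.mem b a ∨ b = a := by
  rcases ha.trichotomy hb with h' | h' | h'
  · exact absurd h' h
  · exact Or.inr h'.symm
  · exact Or.inl h'

theorem subset_of_le (hb : S.IsOrdinal b) (h : S.mem a b ∨ a = b) (hx : S.mem x a) : S.mem x b := by
  rcases h with h | rfl
  · exact hb.trans hx h
  · exact hx

theorem lt_of_le_of_lt (hc : S.IsOrdinal c) (h : S.mem a b ∨ a = b) (h' : S.mem b c) :
    S.mem a c := by
  rcases h with h | rfl
  · exact hc.trans h h'
  · exact h'

theorem le_of_subset (ha : S.IsOrdinal a) (hb : S.IsOrdinal b)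
    (h : ∀ z, S.mem z a → S.mem z b) : S.mem a b ∨ a = b :=
  hb.not_mem ha fun h' => mem_irrefl b (h b h')

end IsOrdinal

theorem isOrdinal_of_transitive {a : V} (h : ∀ x, S.mem x a → S.IsOrdinal x)
    (ht : ∀ x y, S.mem x y → S.mem y a → S.mem x a) : S.IsOrdinal a :=
  ⟨ht, fun x y hx hy => (h x hx).trichotomy (h y hy)⟩

theorem mem_succ {x a : V} : S.mem x (S.succ a) ↔ S.mem x a ∨ x = a :=
  mem_collect ((small_mem a).or (small_singleton a))

theorem self_mem_succ (a : V) : S.mem a (S.succ a) := mem_succ.2 (Or.inr rfl)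

theorem IsOrdinal.succ {a : V} (ha : S.IsOrdinal a) : S.IsOrdinal (S.succ a) := by
  refine isOrdinal_of_transitive (fun x hx => ?_) fun x y hx hy => ?_
  · rcases mem_succ.1 hx with h | rfl
    exacts [ha.of_mem h, ha]
  · rw [mem_succ] at hy ⊢
    exact Or.inl (ha.subset_of_le hy hx)

instance DefFun.succ {t : (Fin n → V) → V} [S.DefFun t] : S.DefFun fun v => S.succ (t v) :=
  comp₁ (f := S.succ) (by unfold SecondOrderStructure.succ; infer_instance)

theorem Small.exists_ordinal_bound {P : V → Prop} (hP : S.Small P)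
    (h : ∀ x, P x → S.IsOrdinal x) : ∃ β, S.IsOrdinal β ∧ ∀ x, P x → S.mem x β := by
  obtain ⟨b, hb⟩ := hP.biUnion (fun x z => S.mem z (S.succ x)) fun x _ => small_mem _
  refine ⟨b, isOrdinal_of_transitive (fun x hx => ?_) fun x y hx hy => ?_, fun x hx => ?_⟩
  · obtain ⟨y, hy, hx⟩ := (hb x).1 hx
    exact (h y hy).succ.of_mem hx
  · obtain ⟨z, hz, hy⟩ := (hb y).1 hy
    exact (hb x).2 ⟨z, hz, (h z hz).succ.trans hx hy⟩
  · exact (hb x).2 ⟨x, hx, self_mem_succ x⟩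

/-- Otherwise every ordinal is zero or a successor, so by induction all ordinals lie in the set
given by infinity, which is the Burali-Forti contradiction. -/
theorem exists_limit : ∃ a, S.IsOrdinal a ∧ (∃ z, S.mem z a) ∧ S.SuccClosed a := by
  by_contra! hc
  obtain ⟨a, ⟨x, hx, hx0⟩, ha⟩ := hS.out.infinity
  have key (α : V) : S.IsOrdinal α → S.mem α a := by
    refine mem_induction (S := S) (P := fun α => S.IsOrdinal α → S.mem α a) (fun α ih hα => ?_) α
    by_cases h0 : ∃ z, S.mem z α
    · have := hc α hα h0
      simp only [SuccClosed, not_forall] at this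
      obtain ⟨ξ, hξ, hξ'⟩ := this
      have hξo := hα.of_mem hξ
      have : S.succ ξ = α := by
        rcases hξo.succ.not_mem hα hξ' with h | h
        · rcases mem_succ.1 h with h | rfl
          · exact absurd hξ (mem_asymm h)
          · exact absurd hξ (mem_irrefl α)
        · exact h.symm
      obtain ⟨y, hy, hy'⟩ := ha ξ (ih ξ hξ hξo)
      rw [← this]
      convert hy
      exact ext fun z => mem_succ.trans (hy' z).symm
    · push Not at h0
      convert hx
      exact ext fun z => iff_of_false (h0 z) (hx0 z)
  obtain ⟨β, hβ, h⟩ := ((small_mem a).mono (P := S.IsOrdinal) key).exists_ordinal_bound fun _ h => h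
  exact mem_irrefl β (h β hβ)

/-! ### Recursion along the ordinals -/

section Recursion

theorem small_setRel (r η : V) : S.Small fun x => S.SetRel r η x :=
  ((small_mem r).image (fun p x => p = S.pair η x) fun p x y h h' =>
    (pair_inj.1 (h.symm.trans h')).2).congr fun x => by simp [setRel_iff]

theorem mem_sect {r η x : V} : S.mem x (S.sect r η) ↔ S.SetRel r η x :=
  mem_collect (small_setRel r η)

instance DefFun.sect {t u : (Fin n → V) → V} [S.DefFun t] [S.DefFun u] :
    S.DefFun fun v => S.sect (t v) (u v) :=
  comp₂ (f := S.sect) (by unfold SecondOrderStructure.sect; infer_instance)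

variable {Φ : V → V} [hΦ : S.DefFun fun v : Fin 1 → V => Φ (v 0)]

instance DefPred.isStage {t u : (Fin n → V) → V} [S.DefFun t] [S.DefFun u] :
    S.DefPred fun v => S.IsStage Φ (t v) (u v) := by
  have {n} {t : (Fin n → V) → V} [S.DefFun t] : S.DefFun fun v => Φ (t v) := DefFun.comp₁ hΦ
  exact DefPred.comp₂ (P := S.IsStage Φ) (by unfold IsStage; infer_instance)

instance DefFun.recUnion {t : (Fin n → V) → V} [S.DefFun t] :
    S.DefFun fun v => S.recUnion Φ (t v) :=
  comp₁ (f := S.recUnion Φ) (by unfold SecondOrderStructure.recUnion; infer_instance)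

theorem IsStage.unique {r θ r' θ' : V} (hθ : S.IsOrdinal θ) (hθ' : S.IsOrdinal θ')
    (h : S.IsStage Φ r θ) (h' : S.IsStage Φ r' θ') (η : V) :
    S.mem η θ → S.mem η θ' → S.sect r η = S.sect r' η := by
  refine mem_induction (S := S)
    (P := fun η => S.mem η θ → S.mem η θ' → S.sect r η = S.sect r' η) (fun η ih hη hη' => ?_) η
  refine ext (S := S) fun x => ?_
  rw [mem_sect, mem_sect, h η hη, h' η hη']
  refine exists_congr fun ξ => and_congr_right fun hξ => ?_
  rw [ih ξ hξ (hθ.trans hξ hη) (hθ'.trans hξ hη')]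

theorem IsStage.recUnion_eq {r θ η : V} (hθ : S.IsOrdinal θ) (h : S.IsStage Φ r θ)
    (hη : S.mem η θ) : S.recUnion Φ η = S.sect r η := by
  have key (x : V) : S.mem x (S.sect r η) ↔
      ∃ r θ, S.IsOrdinal θ ∧ S.IsStage Φ r θ ∧ S.mem η θ ∧ S.SetRel r η x := by
    constructor
    · exact fun hx => ⟨r, θ, hθ, h, hη, mem_sect.1 hx⟩
    · rintro ⟨r', θ', hθ', h', hη', hx⟩
      rw [h.unique hθ hθ' h' η hη hη']
      exact mem_sect.2 hx
  exact ext fun x => (mem_collect ⟨_, key⟩).trans (key x).symm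

/-- The stage is written down directly from the values of `recUnion`. The inductive hypothesis, a
stage for each ξ in θ, shows that these values obey the recursion. -/
theorem exists_isStage (θ : V) : S.IsOrdinal θ → ∃ r, S.IsStage Φ r θ := by
  have {n} {t : (Fin n → V) → V} [S.DefFun t] : S.DefFun fun v => Φ (t v) := DefFun.comp₁ hΦ
  refine mem_induction (S := S) (P := fun θ => S.IsOrdinal θ → ∃ r, S.IsStage Φ r θ)
    (fun θ ih hθ => ?_) θ
  have hs (ξ : V) : S.Small fun x => ∃ η, S.mem η ξ ∧ S.mem x (Φ (S.recUnion Φ η)) :=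
    (small_mem ξ).biUnion (fun η x => S.mem x (Φ (S.recUnion Φ η))) fun η _ => small_mem _
  obtain ⟨r, hr⟩ := (small_mem θ).biUnion
    (fun ξ p => ∃ x, (∃ η, S.mem η ξ ∧ S.mem x (Φ (S.recUnion Φ η))) ∧ p = S.pair ξ x)
    fun ξ _ => (hs ξ).imageFun (S.pair ξ)
  have hr' {ξ x : V} (hξ : S.mem ξ θ) :
      S.SetRel r ξ x ↔ ∃ η, S.mem η ξ ∧ S.mem x (Φ (S.recUnion Φ η)) := by
    rw [setRel_iff, hr]
    constructor
    · rintro ⟨ξ', -, x', h, e⟩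
      obtain ⟨rfl, rfl⟩ := pair_inj.1 e
      exact h
    · exact fun h => ⟨ξ, hξ, x, h, rfl⟩
  refine ⟨r, fun ξ hξ x => (hr' hξ).trans ?_⟩
  obtain ⟨r', h'⟩ := ih ξ hξ (hθ.of_mem hξ)
  have hξo := hθ.of_mem hξ
  refine exists_congr fun η => and_congr_right fun hη => ?_
  suffices S.recUnion Φ η = S.sect r η by rw [this]
  rw [h'.recUnion_eq hξo hη]
  refine ext (S := S) fun x => ?_
  rw [mem_sect, mem_sect, h' η hη, hr' (hθ.trans hη hξ)]
  refine exists_congr fun ζ => and_congr_right fun hζ => ?_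
  rw [h'.recUnion_eq hξo (hξo.trans hζ hη)]

theorem mem_recUnion {α x : V} (hα : S.IsOrdinal α) :
    S.mem x (S.recUnion Φ α) ↔ ∃ ξ, S.mem ξ α ∧ S.mem x (Φ (S.recUnion Φ ξ)) := by
  obtain ⟨r, hr⟩ := exists_isStage (Φ := Φ) _ hα.succ
  rw [hr.recUnion_eq hα.succ (self_mem_succ α), mem_sect, hr α (self_mem_succ α)]
  refine exists_congr fun ξ => and_congr_right fun hξ => ?_
  rw [hr.recUnion_eq hα.succ (mem_succ.2 (Or.inl hξ))]

end Recursion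

/-! ### The cumulative hierarchy and rank -/

section Rank

theorem mem_powerset {x z : V} :
    S.mem z (S.powerset x) ↔ ∀ w, S.mem w z → S.mem w x :=
  mem_collect (small_subset x)

instance DefFun.powerset {t : (Fin n → V) → V} [S.DefFun t] : S.DefFun fun v => S.powerset (t v) :=
  comp₁ (f := S.powerset) (by unfold SecondOrderStructure.powerset; infer_instance)

instance DefFun.level {t : (Fin n → V) → V} [S.DefFun t] : S.DefFun fun v => S.level (t v) :=
  comp₁ (f := S.level) (by unfold SecondOrderStructure.level; infer_instance)

instance DefFun.rank {t : (Fin n → V) → V} [S.DefFun t] : S.DefFun fun v => S.rank (t v) :=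
  comp₁ (f := S.rank) (by unfold SecondOrderStructure.rank; infer_instance)

theorem mem_level {α x : V} (hα : S.IsOrdinal α) :
    S.mem x (S.level α) ↔ ∃ ξ, S.mem ξ α ∧ ∀ y, S.mem y x → S.mem y (S.level ξ) := by
  simp only [level, mem_recUnion hα, mem_powerset]

theorem level_mono {α β x : V} (hβ : S.IsOrdinal β) (h : S.mem α β ∨ α = β)
    (hx : S.mem x (S.level α)) : S.mem x (S.level β) := by
  rcases h with h | rfl
  · rw [mem_level (hβ.of_mem h)] at hx
    obtain ⟨ξ, hξ, hx⟩ := hx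
    exact (mem_level hβ).2 ⟨ξ, hβ.trans hξ h, hx⟩
  · exact hx

/-- `rank x` is meaningful only if the ordinals ξ with x ⊄ V_ξ form a set. The hypothesis bounds
them; `exists_subset_level` later supplies it for every x. -/
theorem rank_aux {x : V} (h : ∃ α, S.IsOrdinal α ∧ ∀ y, S.mem y x → S.mem y (S.level α)) :
    S.IsOrdinal (S.rank x) ∧ ∀ ξ, S.mem ξ (S.rank x) ↔
      S.IsOrdinal ξ ∧ ¬ ∀ y, S.mem y x → S.mem y (S.level ξ) := by
  obtain ⟨α, hα, h⟩ := h
  have hs : S.Small fun ξ => S.IsOrdinal ξ ∧ ¬ ∀ y, S.mem y x → S.mem y (S.level ξ) := by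
    refine (small_mem α).mono fun ξ hξ => ?_
    by_contra hξα
    exact hξ.2 fun y hy => level_mono hξ.1 (hξ.1.not_mem hα hξα) (h y hy)
  have hm (ξ : V) : S.mem ξ (S.rank x) ↔
      S.IsOrdinal ξ ∧ ¬ ∀ y, S.mem y x → S.mem y (S.level ξ) := mem_collect hs
  refine ⟨isOrdinal_of_transitive (fun ξ hξ => ((hm ξ).1 hξ).1) fun ξ η hξ hη => ?_, hm⟩
  rw [hm] at hη ⊢
  exact ⟨hη.1.of_mem hξ, fun h' => hη.2 fun y hy => level_mono hη.1 (Or.inl hξ) (h' y hy)⟩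

theorem exists_subset_level (x : V) :
    ∃ α, S.IsOrdinal α ∧ ∀ y, S.mem y x → S.mem y (S.level α) := by
  refine mem_induction (S := S)
    (P := fun x => ∃ α, S.IsOrdinal α ∧ ∀ y, S.mem y x → S.mem y (S.level α)) (fun x ih => ?_) x
  obtain ⟨β, hβ, h⟩ := ((small_mem x).imageFun S.rank).exists_ordinal_bound (by
    rintro _ ⟨y, hy, rfl⟩
    exact (rank_aux (ih y hy)).1)
  refine ⟨β, hβ, fun y hy => (mem_level hβ).2 ⟨S.rank y, h _ ⟨y, hy, rfl⟩, ?_⟩⟩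
  obtain ⟨ho, hm⟩ := rank_aux (ih y hy)
  by_contra hc
  exact mem_irrefl _ ((hm (S.rank y)).2 ⟨ho, hc⟩)

theorem isOrdinal_rank (x : V) : S.IsOrdinal (S.rank x) := (rank_aux (exists_subset_level x)).1

theorem mem_rank {x ξ : V} : S.mem ξ (S.rank x) ↔
    S.IsOrdinal ξ ∧ ¬ ∀ y, S.mem y x → S.mem y (S.level ξ) :=
  (rank_aux (exists_subset_level x)).2 ξ

theorem mem_level_iff {x α : V} (hα : S.IsOrdinal α) :
    S.mem x (S.level α) ↔ S.mem (S.rank x) α := by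
  rw [mem_level hα]
  constructor
  · rintro ⟨ξ, hξ, h⟩
    refine hα.lt_of_le_of_lt ((hα.of_mem hξ).not_mem (isOrdinal_rank x) fun h' => ?_) hξ
    exact (mem_rank.1 h').2 h
  · refine fun h => ⟨_, h, ?_⟩
    by_contra hc
    exact mem_irrefl _ (mem_rank.2 ⟨isOrdinal_rank x, hc⟩)

theorem small_rank_lt {α : V} (hα : S.IsOrdinal α) : S.Small fun x => S.mem (S.rank x) α :=
  ⟨S.level α, fun _ => mem_level_iff hα⟩

theorem rank_le {x α : V} (hα : S.IsOrdinal α) (h : ∀ y, S.mem y x → S.mem (S.rank y) α) :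
    S.mem (S.rank x) α ∨ S.rank x = α :=
  hα.not_mem (isOrdinal_rank x) fun h' =>
    (mem_rank.1 h').2 fun y hy => (mem_level_iff hα).2 (h y hy)

theorem rank_lt_of_mem {x y : V} (h : S.mem y x) : S.mem (S.rank y) (S.rank x) := by
  rw [← mem_level_iff (isOrdinal_rank x)]
  by_contra hc
  exact mem_irrefl _ (mem_rank.2 ⟨isOrdinal_rank x, fun h' => hc (h' y h)⟩)

theorem IsOrdinal.rank_eq {α : V} : S.IsOrdinal α → S.rank α = α := by
  refine mem_induction (S := S) (P := fun α => S.IsOrdinal α → S.rank α = α) (fun α ih hα => ?_) α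
  have h1 := rank_le hα fun ξ hξ => by rwa [ih ξ hξ (hα.of_mem hξ)]
  rcases h1 with h | h
  · have := rank_lt_of_mem h
    rw [ih _ h (isOrdinal_rank α)] at this
    exact absurd this (mem_irrefl _)
  · exact h

theorem rank_lt_of_subset {x y α : V} (hα : S.IsOrdinal α) (h : ∀ z, S.mem z x → S.mem z y)
    (hy : S.mem (S.rank y) α) : S.mem (S.rank x) α :=
  hα.lt_of_le_of_lt (rank_le (isOrdinal_rank y) fun z hz => rank_lt_of_mem (h z hz)) hy

theorem rank_lt_of_doubleton {x y z β : V} (hβ : S.IsOrdinal β) (h : S.SuccClosed β)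
    (hx : S.mem (S.rank x) β) (hy : S.mem (S.rank y) β)
    (hz : ∀ w, S.mem w z → w = x ∨ w = y) : S.mem (S.rank z) β := by
  obtain ⟨δ, hδ, hxδ, hyδ⟩ : ∃ δ, S.mem δ β ∧ S.mem (S.rank x) δ ∧ S.mem (S.rank y) δ := by
    have ox := isOrdinal_rank (S := S) x
    have oy := isOrdinal_rank (S := S) y
    rcases ox.trichotomy oy with h' | h' | h'
    · exact ⟨_, h _ hy, mem_succ.2 (Or.inl h'), self_mem_succ _⟩
    · exact ⟨_, h _ hy, mem_succ.2 (Or.inr h'), self_mem_succ _⟩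
    · exact ⟨_, h _ hx, self_mem_succ _, mem_succ.2 (Or.inl h')⟩
  refine hβ.lt_of_le_of_lt (rank_le (hβ.of_mem hδ) fun w hw => ?_) hδ
  rcases hz w hw with rfl | rfl
  exacts [hxδ, hyδ]

theorem rank_pair_lt {x y β : V} (hβ : S.IsOrdinal β) (h : S.SuccClosed β)
    (hx : S.mem (S.rank x) β) (hy : S.mem (S.rank y) β) : S.mem (S.rank (S.pair x y)) β := by
  obtain ⟨a, ha⟩ := small_singleton (S := S) x
  obtain ⟨b, hb⟩ := small_doubleton (S := S) x y
  refine rank_lt_of_doubleton (x := a) (y := b) hβ h ?_ ?_ fun z hz => ?_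
  · exact rank_lt_of_doubleton hβ h hx hx fun w hw => Or.inl ((ha w).1 hw)
  · exact rank_lt_of_doubleton hβ h hx hy fun w hw => (hb w).1 hw
  · refine ((isPair_pair x y z).1 hz).imp (fun h => ?_) fun h => ?_
    · exact ext fun w => (h w).trans (ha w).symm
    · exact ext fun w => (h w).trans (hb w).symm

theorem rank_lt_of_pair {x y β : V} (hβ : S.IsOrdinal β)
    (h : S.mem (S.rank (S.pair x y)) β) : S.mem (S.rank x) β ∧ S.mem (S.rank y) β := by
  obtain ⟨b, hb⟩ := small_doubleton (S := S) x y
  have hb' : S.mem b (S.pair x y) := (isPair_pair x y b).2 (Or.inr hb)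
  have hbr := hβ.trans (rank_lt_of_mem hb') h
  exact ⟨hβ.trans (rank_lt_of_mem ((hb x).2 (Or.inl rfl))) hbr,
    hβ.trans (rank_lt_of_mem ((hb y).2 (Or.inr rfl))) hbr⟩

end Rank

/-- Start from α + 1 and close off repeatedly along a nonzero limit ordinal; every demand met at one
stage is satisfied at the next. -/
theorem exists_closed_above (g : V → V) [hg : S.DefFun fun v : Fin 1 → V => g (v 0)]
    (ho : ∀ x, S.IsOrdinal (g x)) {α : V} (hα : S.IsOrdinal α) :
    ∃ β, S.IsOrdinal β ∧ S.mem α β ∧ S.SuccClosed β ∧ ∀ ξ, S.mem ξ β → S.mem (g ξ) β := by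
  have {n} {t : (Fin n → V) → V} [S.DefFun t] : S.DefFun fun v => g (t v) := DefFun.comp₁ hg
  obtain ⟨ω, hω, ⟨z, hz⟩, hlim⟩ := exists_limit (S := S)
  -- Each ξ contributes all η ≤ ξ + 1 and all η ≤ g ξ. Taking whole initial segments makes the union
  -- transitive, hence an ordinal.
  let B : V → V → Prop := fun ξ η => S.mem η (S.succ (S.succ ξ)) ∨ S.mem η (S.succ (g ξ))
  let Φ : V → V := fun s => S.collect fun η => S.IsOrdinal η ∧
    (S.mem η (S.succ α) ∨ ∃ ξ, S.mem ξ s ∧ B ξ η)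
  have hΦ : S.DefFun fun v : Fin 1 → V => Φ (v 0) := by
    simp only [Φ, B]; infer_instance
  have mem_Φ {η s : V} : S.mem η (Φ s) ↔ S.IsOrdinal η ∧
      (S.mem η (S.succ α) ∨ ∃ ξ, S.mem ξ s ∧ B ξ η) := by
    refine mem_collect (((small_mem (S.succ α)).or ((small_mem s).biUnion B (hQ := ?_) fun ξ _ =>
      (small_mem _).or (small_mem _))).mono (hP := ?_) fun _ h => h.2) <;>
    · simp only [B]; infer_instance
  have hmem {x : V} := mem_recUnion (Φ := Φ) (x := x) hω
  have step {ξ η : V} (hξ : S.mem ξ (S.recUnion Φ ω)) (hη : S.IsOrdinal η) (h : B ξ η) :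
      S.mem η (S.recUnion Φ ω) := by
    obtain ⟨m, hm, hξ⟩ := hmem.1 hξ
    refine hmem.2 ⟨S.succ m, hlim m hm, mem_Φ.2 ⟨hη, Or.inr ⟨ξ, ?_, h⟩⟩⟩
    exact (mem_recUnion (hω.of_mem hm).succ).2 ⟨m, self_mem_succ m, hξ⟩
  have hord (x : V) (hx : S.mem x (S.recUnion Φ ω)) : S.IsOrdinal x := by
    obtain ⟨m, hm, hx⟩ := hmem.1 hx
    exact (mem_Φ.1 hx).1
  refine ⟨S.recUnion Φ ω, isOrdinal_of_transitive hord fun x y hxy hy => ?_, ?_, fun ξ hξ => ?_,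
    fun ξ hξ => ?_⟩
  · exact step hy ((hord y hy).of_mem hxy) (Or.inl (mem_succ.2 (Or.inl (mem_succ.2 (Or.inl hxy)))))
  · exact hmem.2 ⟨z, hz, mem_Φ.2 ⟨hα, Or.inl (self_mem_succ α)⟩⟩
  · exact step hξ (hord ξ hξ).succ (Or.inl (self_mem_succ _))
  · exact step hξ (ho ξ) (Or.inr (self_mem_succ _))

end

/-! ### Functions, graphs and homomorphisms as sets -/

section
variable {V : Type u} (S : SecondOrderStructure V)

/-- The first component of a pair. -/
noncomputable def fst [Nonempty V] (p : V) : V :=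
  S.collect fun z => ∃ x y, p = S.pair x y ∧ S.mem z x

/-- The second component of a pair. -/
noncomputable def snd [Nonempty V] (p : V) : V :=
  S.collect fun z => ∃ x y, p = S.pair x y ∧ S.mem z y

/-- The value at `x` of a function that is a set. -/
noncomputable def app [Nonempty V] (h x : V) : V :=
  S.collect fun z => ∃ y, S.SetRel h x y ∧ S.mem z y

/-- The domain of a relation that is a set. -/
noncomputable def dom [Nonempty V] (h : V) : V :=
  S.collect fun x => ∃ y, S.SetRel h x y

/-- The restriction of a function to a set, as a set. -/
noncomputable def lam [Nonempty V] (a : V) (f : V → V) : V :=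
  S.collect fun p => ∃ x, S.mem x a ∧ p = S.pair x (f x)

/-- There is an edge from `x` to `y` in the graph `G`. -/
def Edge [Nonempty V] (G x y : V) : Prop := S.SetRel (S.snd G) x y

variable {S} {n : ℕ} [Nonempty V] [hS : Fact S.ModelsGBAC]

section Def

variable {t u w : (Fin n → V) → V} [S.DefFun t] [S.DefFun u] [S.DefFun w]

instance DefFun.fst : S.DefFun fun v => S.fst (t v) :=
  comp₁ (f := S.fst) (by unfold SecondOrderStructure.fst; infer_instance)

instance DefFun.snd : S.DefFun fun v => S.snd (t v) :=
  comp₁ (f := S.snd) (by unfold SecondOrderStructure.snd; infer_instance)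

instance DefFun.app : S.DefFun fun v => S.app (t v) (u v) :=
  comp₂ (f := S.app) (by unfold SecondOrderStructure.app; infer_instance)

instance DefFun.dom : S.DefFun fun v => S.dom (t v) :=
  comp₁ (f := S.dom) (by unfold SecondOrderStructure.dom; infer_instance)

instance DefPred.edge : S.DefPred fun v => S.Edge (t v) (u v) (w v) :=
  comp₃ (P := S.Edge) (by unfold Edge; infer_instance)

end Def

theorem fst_pair (x y : V) : S.fst (S.pair x y) = x := by
  have (z : V) : S.mem z x ↔ ∃ x' y', S.pair x y = S.pair x' y' ∧ S.mem z x' := by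
    simp [pair_inj]
  exact ext fun z => (mem_collect ⟨x, this⟩).trans (this z).symm

theorem snd_pair (x y : V) : S.snd (S.pair x y) = y := by
  have (z : V) : S.mem z y ↔ ∃ x' y', S.pair x y = S.pair x' y' ∧ S.mem z y' := by
    simp [pair_inj]
  exact ext fun z => (mem_collect ⟨y, this⟩).trans (this z).symm

theorem app_eq {h x y : V} (hy : ∀ z, S.SetRel h x z ↔ z = y) : S.app h x = y := by
  simp only [app, hy, exists_eq_left, collect_mem]

theorem mem_dom {h x : V} : S.mem x (S.dom h) ↔ ∃ y, S.SetRel h x y := by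
  refine mem_collect (((small_mem h).imageFun S.fst).mono fun x hx => ?_)
  obtain ⟨y, hy⟩ := hx
  exact ⟨_, setRel_iff.1 hy, (fst_pair x y).symm⟩

section Lam

variable {a b : V} {f : V → V} [hf : S.DefFun fun v : Fin 1 → V => f (v 0)]

theorem mem_lam {p : V} : S.mem p (S.lam a f) ↔ ∃ x, S.mem x a ∧ p = S.pair x (f x) := by
  have {n} {t : (Fin n → V) → V} [S.DefFun t] : S.DefFun fun v => f (t v) := DefFun.comp₁ hf
  exact mem_collect ((small_mem a).imageFun fun x => S.pair x (f x))

theorem setRel_lam {x y : V} : S.SetRel (S.lam a f) x y ↔ S.mem x a ∧ y = f x := by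
  rw [setRel_iff, mem_lam]
  constructor
  · rintro ⟨x', h, e⟩
    obtain ⟨rfl, rfl⟩ := pair_inj.1 e
    exact ⟨h, rfl⟩
  · rintro ⟨h, rfl⟩
    exact ⟨x, h, rfl⟩

theorem app_lam {x : V} (hx : S.mem x a) : S.app (S.lam a f) x = f x :=
  app_eq fun z => by simp [setRel_lam, hx]

theorem dom_lam : S.dom (S.lam a f) = a :=
  ext (S := S) fun x => by simp [mem_dom, setRel_lam]

theorem isFunction_lam (h : ∀ x, S.mem x a → S.mem (f x) b) : S.IsFunction (S.lam a f) a b := by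
  refine ⟨fun p hp => ?_, fun x hx => ⟨f x, ?_, fun y hy => ?_⟩⟩
  · obtain ⟨x, hx, rfl⟩ := mem_lam.1 hp
    exact ⟨x, f x, hx, h x hx, isPair_pair _ _⟩
  · exact setRel_lam.2 ⟨hx, rfl⟩
  · exact (setRel_lam.1 hy).2

end Lam

namespace IsFunction

variable {h h' a b x y : V}

theorem mem_of_setRel (hf : S.IsFunction h a b) (hx : S.SetRel h x y) : S.mem x a ∧ S.mem y b := by
  obtain ⟨x', y', hx', hy', e⟩ := hf.1 _ (setRel_iff.1 hx)
  obtain ⟨rfl, rfl⟩ := pair_inj.1 (isPair_iff.1 e)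
  exact ⟨hx', hy'⟩

theorem setRel_iff_app (hf : S.IsFunction h a b) (hx : S.mem x a) :
    S.SetRel h x y ↔ y = S.app h x := by
  obtain ⟨y', hy', hu⟩ := hf.2 x hx
  have : ∀ z, S.SetRel h x z ↔ z = y' := fun z => ⟨hu z, by rintro rfl; exact hy'⟩
  rw [this, app_eq this]

theorem app_mem (hf : S.IsFunction h a b) (hx : S.mem x a) : S.mem (S.app h x) b :=
  (hf.mem_of_setRel ((hf.setRel_iff_app hx).2 rfl)).2

theorem mem_iff (hf : S.IsFunction h a b) {p : V} :
    S.mem p h ↔ ∃ x, S.mem x a ∧ p = S.pair x (S.app h x) := by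
  constructor
  · intro hp
    obtain ⟨x, y, hx, hy, e⟩ := hf.1 p hp
    obtain rfl := isPair_iff.1 e
    exact ⟨x, hx, by rw [← (hf.setRel_iff_app hx).1 (setRel_iff.2 hp)]⟩
  · rintro ⟨x, hx, rfl⟩
    exact setRel_iff.1 ((hf.setRel_iff_app hx).2 rfl)

theorem eq_of_app (hf : S.IsFunction h a b) (hf' : S.IsFunction h' a b)
    (e : ∀ x, S.mem x a → S.app h x = S.app h' x) : h = h' := by
  refine ext (S := S) fun p => ?_
  rw [hf.mem_iff, hf'.mem_iff]
  exact exists_congr fun x => and_congr_right fun hx => by rw [e x hx]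

end IsFunction

theorem isGraph_iff {G : V} : S.IsGraph G ↔ S.IsGraphOn G (S.fst G) (S.snd G) := by
  refine ⟨?_, fun h => ⟨_, _, h⟩⟩
  rintro ⟨v, e, h⟩
  obtain rfl := isPair_iff.1 h.1
  rwa [fst_pair, snd_pair]

theorem IsGraph.mem_of_edge {G x y : V} (hG : S.IsGraph G) (h : S.Edge G x y) :
    S.mem x (S.fst G) ∧ S.mem y (S.fst G) := by
  obtain ⟨x', y', hx, hy, e⟩ := (isGraph_iff.1 hG).2 _ (setRel_iff.1 h)
  obtain ⟨rfl, rfl⟩ := pair_inj.1 (isPair_iff.1 e)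
  exact ⟨hx, hy⟩

theorem isHom_iff {G H h : V} (hG : S.IsGraph G) (hH : S.IsGraph H) :
    S.IsHom G H h ↔ S.IsFunction h (S.fst G) (S.fst H) ∧
      ∀ x y, S.Edge G x y → S.Edge H (S.app h x) (S.app h y) := by
  constructor
  · rintro ⟨v, e, w, f, hGv, hHw, hf, hh⟩
    obtain rfl := isPair_iff.1 hGv.1
    obtain rfl := isPair_iff.1 hHw.1
    rw [fst_pair, fst_pair]
    refine ⟨hf, fun x y hxy => ?_⟩
    have hm := hG.mem_of_edge hxy
    rw [fst_pair] at hm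
    simp only [Edge, snd_pair] at hxy ⊢
    exact hh x y _ _ hxy ((hf.setRel_iff_app hm.1).2 rfl) ((hf.setRel_iff_app hm.2).2 rfl)
  · rintro ⟨hf, hh⟩
    refine ⟨_, _, _, _, isGraph_iff.1 hG, isGraph_iff.1 hH, hf, fun x y x₁ y₁ hxy hx hy => ?_⟩
    have hm := hG.mem_of_edge hxy
    rw [(hf.setRel_iff_app hm.1).1 hx, (hf.setRel_iff_app hm.2).1 hy]
    exact hh x y hxy

theorem small_isFunction (a b : V) : S.Small fun h => S.IsFunction h a b := by
  refine ((small_mem a).prod (small_mem b)).subset.mono fun h hh p hp => ?_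
  obtain ⟨x, y, hx, hy, e⟩ := hh.1 p hp
  exact ⟨x, hx, y, hy, isPair_iff.1 e⟩

theorem small_isHom {G H : V} (hG : S.IsGraph G) (hH : S.IsGraph H) :
    S.Small fun h => S.IsHom G H h :=
  (small_isFunction (S.fst G) (S.fst H)).mono fun _ h => ((isHom_iff hG hH).1 h).1

/-- The sets `collect (R x)` form a set by replacement. A choice function on it is a single set
parameter, so the selector stays definable without global choice. -/
theorem exists_choice {a : V} (R : V → V → Prop) [hR : S.DefPred fun v : Fin 2 → V => R (v 0) (v 1)]
    (hs : ∀ x, S.mem x a → S.Small (R x)) (he : ∀ x, S.mem x a → ∃ y, R x y) :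
    ∃ H : V → V, (S.DefFun fun v : Fin 1 → V => H (v 0)) ∧ ∀ x, S.mem x a → R x (H x) := by
  have {n} {t u : (Fin n → V) → V} [S.DefFun t] [S.DefFun u] :
      S.DefPred fun v => R (t v) (u v) := hR.comp₂
  obtain ⟨b, hb⟩ := (small_mem (S := S) a).imageFun fun x => S.collect (R x)
  obtain ⟨f, ⟨c, hf⟩, hf'⟩ := hS.out.choice b fun z hz => by
    obtain ⟨x, hx, rfl⟩ := (hb z).1 hz
    obtain ⟨y, hy⟩ := he x hx
    exact ⟨y, (mem_collect (hs x hx)).2 hy⟩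
  refine ⟨fun x => S.app f (S.collect (R x)), inferInstance, fun x hx => ?_⟩
  exact (mem_collect (hs x hx)).1
    (hf' _ _ ((hf.setRel_iff_app ((hb _).2 ⟨x, hx, rfl⟩)).2 rfl))

/-! ### Graphs whose vertices carry finitely many sorts -/

section TaggedGraph

variable {ι : Type} [Finite ι]

variable (S) in
/-- The graph whose vertices are the pairs `(c i, x)` with `vt i x`, and whose edges are given by
`ed`. -/
noncomputable def taggedGraph (c : ι → V) (vt : ι → V → Prop) (ed : ι → ι → V → V → Prop) : V :=
  S.pair (S.collect fun z => ∃ i, ∃ x, vt i x ∧ z = S.pair (c i) x)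
    (S.collect fun p => ∃ i j, ∃ x y, vt i x ∧ vt j y ∧ ed i j x y ∧
      p = S.pair (S.pair (c i) x) (S.pair (c j) y))

variable {c : ι → V} {vt vt' : ι → V → Prop} {ed ed' : ι → ι → V → V → Prop}

/-- A family of typed vertices and edges that are definable and form sets. -/
structure IsTagged (S : SecondOrderStructure V) (c : ι → V) (vt : ι → V → Prop)
    (ed : ι → ι → V → V → Prop) : Prop where
  injective : Function.Injective c
  small i : S.Small (vt i)
  vt_def i : S.DefPred fun v : Fin 1 → V => vt i (v 0)
  ed_def i j : S.DefPred fun v : Fin 2 → V => ed i j (v 0) (v 1)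

theorem IsTagged.mem_fst (h : S.IsTagged c vt ed) {z : V} :
    S.mem z (S.fst (S.taggedGraph c vt ed)) ↔ ∃ i x, vt i x ∧ z = S.pair (c i) x := by
  have {n} {t : (Fin n → V) → V} [S.DefFun t] {i} : S.DefPred fun v => vt i (t v) :=
    (h.vt_def i).comp₁
  rw [taggedGraph, fst_pair]
  cases nonempty_fintype ι
  have (s : Finset ι) : S.Small fun z => ∃ i ∈ s, ∃ x, vt i x ∧ z = S.pair (c i) x := by
    classical
    induction s using Finset.induction_on with
    | empty => exact (small_mem (Classical.arbitrary V)).mono (by simp)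
    | insert i s _ ih =>
      exact (((h.small i).imageFun (S.pair (c i))).or ih).congr fun z => by simp
  exact mem_collect ((this Finset.univ).congr fun z => by simp)

theorem IsTagged.edge_iff' (h : S.IsTagged c vt ed) {p : V} :
    S.mem p (S.snd (S.taggedGraph c vt ed)) ↔ ∃ i j, ∃ x y, vt i x ∧ vt j y ∧ ed i j x y ∧
      p = S.pair (S.pair (c i) x) (S.pair (c j) y) := by
  have {n} {t : (Fin n → V) → V} [S.DefFun t] {i} : S.DefPred fun v => vt i (t v) :=
    (h.vt_def i).comp₁
  have {n} {t u : (Fin n → V) → V} [S.DefFun t] [S.DefFun u] {i j} :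
    S.DefPred fun v => ed i j (t v) (u v) := (h.ed_def i j).comp₂
  have hv {z : V} := h.mem_fst (z := z)
  rw [taggedGraph, snd_pair]
  refine mem_collect (((small_mem (S.fst (S.taggedGraph c vt ed))).prod
    (small_mem (S.fst (S.taggedGraph c vt ed)))).mono fun p hp => ?_)
  obtain ⟨i, j, x, y, hx, hy, -, rfl⟩ := hp
  exact ⟨_, hv.2 ⟨i, x, hx, rfl⟩, _, hv.2 ⟨j, y, hy, rfl⟩, rfl⟩

theorem IsTagged.edge_iff (h : S.IsTagged c vt ed) {i j : ι} {x y : V} :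
    S.Edge (S.taggedGraph c vt ed) (S.pair (c i) x) (S.pair (c j) y) ↔
      vt i x ∧ vt j y ∧ ed i j x y := by
  rw [Edge, setRel_iff, h.edge_iff']
  constructor
  · rintro ⟨i', j', x', y', hx, hy, he, e⟩
    simp only [pair_inj] at e
    obtain ⟨⟨hi, rfl⟩, hj, rfl⟩ := e
    obtain rfl := h.injective hi
    obtain rfl := h.injective hj
    exact ⟨hx, hy, he⟩
  · rintro ⟨hx, hy, he⟩
    exact ⟨i, j, x, y, hx, hy, he, rfl⟩

theorem IsTagged.isGraph (h : S.IsTagged c vt ed) : S.IsGraph (S.taggedGraph c vt ed) := by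
  refine isGraph_iff.2 ⟨?_, fun p hp => ?_⟩
  · rw [taggedGraph, fst_pair, snd_pair]
    exact isPair_pair _ _
  · obtain ⟨i, j, x, y, hx, hy, -, rfl⟩ := h.edge_iff'.1 hp
    exact ⟨_, _, h.mem_fst.2 ⟨i, x, hx, rfl⟩, h.mem_fst.2 ⟨j, y, hy, rfl⟩, isPair_pair _ _⟩

theorem exists_isHom_taggedGraph (h : S.IsTagged c vt ed) (h' : S.IsTagged c vt' ed')
    (φ : ι → V → V) (hφ : ∀ i, S.DefFun fun v : Fin 1 → V => φ i (v 0))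
    (hv : ∀ i x, vt i x → vt' i (φ i x))
    (he : ∀ i j x y, vt i x → vt j y → ed i j x y → ed' i j (φ i x) (φ j y)) :
    ∃ f, S.IsHom (S.taggedGraph c vt ed) (S.taggedGraph c vt' ed') f := by
  have {n} {t : (Fin n → V) → V} [S.DefFun t] {i} : S.DefFun fun v => φ i (t v) :=
    DefFun.comp₁ (hφ i)
  -- Definition by cases on the tag, phrased through members so that a finite disjunction makes it
  -- definable.
  let g : V → V := fun z => S.collect fun w => ∃ i, S.fst z = c i ∧
    S.mem w (S.pair (c i) (φ i (S.snd z)))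
  have hg : S.DefFun fun v : Fin 1 → V => g (v 0) := by simp only [g]; infer_instance
  have gp (i : ι) (x : V) : g (S.pair (c i) x) = S.pair (c i) (φ i x) := by
    have (w : V) : (∃ j, S.fst (S.pair (c i) x) = c j ∧
        S.mem w (S.pair (c j) (φ j (S.snd (S.pair (c i) x))))) ↔
        S.mem w (S.pair (c i) (φ i x)) := by
      rw [fst_pair, snd_pair]
      constructor
      · rintro ⟨j, hj, hw⟩
        rwa [h.injective hj]
      · exact fun hw => ⟨i, rfl, hw⟩
    simp only [g, this, collect_mem]
  have key (i : ι) (x : V) (hx : vt i x) :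
      S.app (S.lam (S.fst (S.taggedGraph c vt ed)) g) (S.pair (c i) x) =
        S.pair (c i) (φ i x) := by
    rw [app_lam (h.mem_fst.2 ⟨i, x, hx, rfl⟩), gp]
  refine ⟨S.lam (S.fst (S.taggedGraph c vt ed)) g, (isHom_iff h.isGraph h'.isGraph).2
    ⟨isFunction_lam fun z hz => ?_, fun z w hzw => ?_⟩⟩
  · obtain ⟨i, x, hx, rfl⟩ := h.mem_fst.1 hz
    rw [gp]
    exact h'.mem_fst.2 ⟨i, _, hv i x hx, rfl⟩
  · obtain ⟨hz, hw⟩ := h.isGraph.mem_of_edge hzw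
    obtain ⟨i, x, hx, rfl⟩ := h.mem_fst.1 hz
    obtain ⟨j, y, hy, rfl⟩ := h.mem_fst.1 hw
    rw [key i x hx, key j y hy]
    exact h'.edge_iff.2 ⟨hv i x hx, hv j y hy, he i j x y hx hy (h.edge_iff.1 hzw).2.2⟩

theorem isHom_taggedGraph_ext (h : S.IsTagged c vt ed) (h' : S.IsTagged c vt' ed')
    {f f' : V} (hf : S.IsHom (S.taggedGraph c vt ed) (S.taggedGraph c vt' ed') f)
    (hf' : S.IsHom (S.taggedGraph c vt ed) (S.taggedGraph c vt' ed') f')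
    (e : ∀ i x, vt i x → S.app f (S.pair (c i) x) = S.app f' (S.pair (c i) x)) : f = f' := by
  rw [isHom_iff h.isGraph h'.isGraph] at hf hf'
  refine hf.1.eq_of_app hf'.1 fun z hz => ?_
  obtain ⟨i, x, hx, rfl⟩ := h.mem_fst.1 hz
  exact e i x hx

theorem isHom_taggedGraph_app (h : S.IsTagged c vt ed) (h' : S.IsTagged c vt' ed')
    {f : V} (hf : S.IsHom (S.taggedGraph c vt ed) (S.taggedGraph c vt' ed') f)
    {i : ι} {x : V} (hx : vt i x) : ∃ j y, vt' j y ∧ S.app f (S.pair (c i) x) = S.pair (c j) y :=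
  h'.mem_fst.1 (((isHom_iff h.isGraph h'.isGraph).1 hf).1.app_mem (h.mem_fst.2 ⟨i, x, hx, rfl⟩))

theorem isHom_taggedGraph_edge (h : S.IsTagged c vt ed) (h' : S.IsTagged c vt' ed')
    {f : V} (hf : S.IsHom (S.taggedGraph c vt ed) (S.taggedGraph c vt' ed') f)
    {i j k l : ι} {x y z w : V} (hx : vt i x) (hy : vt j y) (hxy : ed i j x y)
    (ex : S.app f (S.pair (c i) x) = S.pair (c k) z)
    (ey : S.app f (S.pair (c j) y) = S.pair (c l) w) : ed' k l z w := by
  have := ((isHom_iff h.isGraph h'.isGraph).1 hf).2 _ _ (h.edge_iff.2 ⟨hx, hy, hxy⟩)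
  rw [ex, ey] at this
  exact (h'.edge_iff.1 this).2.2

end TaggedGraph

/-- Supplies distinct tags. The sequence is external and need not be a class; only finitely many of
its values are used as parameters. -/
theorem exists_injective_nat (S : SecondOrderStructure V) [Fact S.ModelsGBAC] :
    ∃ c : ℕ → V, Function.Injective c := by
  obtain ⟨a, ha, -, -⟩ := exists_limit (S := S)
  have ho (k : ℕ) : S.IsOrdinal (S.succ^[k] a) := by
    induction k with
    | zero => exact ha
    | succ k ih => rw [Function.iterate_succ_apply']; exact ih.succ
  have hlt (k l : ℕ) : S.mem (S.succ^[k] a) (S.succ^[k + l + 1] a) := by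
    induction l with
    | zero => rw [Function.iterate_succ_apply']; exact self_mem_succ _
    | succ l ih =>
      rw [show k + (l + 1) + 1 = (k + l + 1) + 1 from rfl, Function.iterate_succ_apply']
      exact mem_succ.2 (Or.inl ih)
  refine ⟨fun k => S.succ^[k] a, fun k l h => ?_⟩
  rcases lt_trichotomy k l with h' | h' | h'
  · obtain ⟨m, rfl⟩ := Nat.exists_eq_add_of_lt h'
    have := hlt k m
    simp only at h
    rw [← h] at this
    exact absurd this (mem_irrefl _)
  · exact h'
  · obtain ⟨m, rfl⟩ := Nat.exists_eq_add_of_lt h'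
    have := hlt l m
    simp only at h
    rw [h] at this
    exact absurd this (mem_irrefl _)

end

/-! ### Points, branches and the maps between them -/

section
variable {V : Type u} (S : SecondOrderStructure V)

/-- A definable sequence of graphs that violates the Semi-Weak Vopěnka Principle. -/
structure IsDescending [Nonempty V] (gr : V → V) : Prop where
  isGraph ξ : S.IsOrdinal ξ → S.IsGraph (gr ξ)
  exists_hom ξ η : S.IsOrdinal ξ → S.IsOrdinal η → S.mem ξ η ∨ ξ = η →
    ∃ h, S.IsHom (gr η) (gr ξ) h
  no_hom ξ η : S.IsOrdinal ξ → S.IsOrdinal η → S.mem ξ η → ¬ ∃ h, S.IsHom (gr ξ) (gr η) h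

/-- The intersection of two sets. -/
noncomputable def inter [Nonempty V] (a b : V) : V := S.collect fun z => S.mem z a ∧ S.mem z b

/-- The ordinal `β` is closed under successors and under the ranks of the graphs `gr ξ`. -/
structure IsClosedPoint [Nonempty V] (gr : V → V) (β : V) : Prop where
  isOrdinal : S.IsOrdinal β
  succClosed : S.SuccClosed β
  rank_lt : ∀ ξ, S.mem ξ β → S.mem (S.rank (gr ξ)) β

/-- The set `f` is a function on an ordinal with `f ξ` a vertex of `gr (ξ + 1)` for all `ξ`. -/
def IsSection [Nonempty V] (gr : V → V) (f : V) : Prop :=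
  (∀ p, S.mem p f ↔ ∃ ξ, S.mem ξ (S.dom f) ∧ p = S.pair ξ (S.app f ξ)) ∧
    ∀ ξ, S.mem ξ (S.dom f) → S.mem (S.app f ξ) (S.fst (gr (S.succ ξ)))

/-- The members of `V_β ∪ {β}`. -/
def IsPoint [Nonempty V] (β x : V) : Prop := S.mem (S.rank x) β ∨ x = β

/-- The sections of length at most `β`. -/
def IsBranch [Nonempty V] (gr : V → V) (β f : V) : Prop :=
  S.IsSection gr f ∧ (S.mem (S.dom f) β ∨ S.dom f = β)

/-- Sections with the same domain that are joined by an edge at every coordinate. -/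
def BranchEdge [Nonempty V] (gr : V → V) (f g : V) : Prop :=
  S.dom f = S.dom g ∧ ∀ ξ, S.mem ξ (S.dom f) → S.Edge (gr (S.succ ξ)) (S.app f ξ) (S.app g ξ)

/-- The map of `V_γ ∪ {γ}` onto `V_β ∪ {β}` that collapses everything outside `V_β` to `β`. -/
noncomputable def trunc [Nonempty V] (β x : V) : V :=
  S.collect fun z => S.mem (S.rank x) β ∧ S.mem z x ∨ ¬ S.mem (S.rank x) β ∧ S.mem z β

/-- The restriction of a section to `β`. -/
noncomputable def restr [Nonempty V] (β f : V) : V := S.lam (S.inter (S.dom f) β) (S.app f)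

/-- Maps between points and branches that respect the relations by which the points and branches
are tied together. -/
structure IsPointMap [Nonempty V] (gr : V → V) (γ β : V) (j k : V → V) : Prop where
  isPoint x : S.IsPoint γ x → S.IsPoint β (j x)
  isBranch f : S.IsBranch gr γ f → S.IsBranch gr β (k f)
  mem x y : S.IsPoint γ x → S.IsPoint γ y → S.mem x y ∨ y = γ → S.mem (j x) (j y) ∨ j y = β
  not_mem x y : S.IsPoint γ x → S.IsPoint γ y → ¬ S.mem x y ∨ y = γ →
    ¬ S.mem (j x) (j y) ∨ j y = β
  dom f x : S.IsBranch gr γ f → S.IsPoint γ x → S.dom f = S.rank x → S.dom (k f) = S.rank (j x)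
  mem_branch x f : S.IsPoint γ x → S.IsBranch gr γ f → S.mem x f ∨ x = γ ∧ S.dom f = γ →
    S.mem (j x) (k f) ∨ j x = β ∧ S.dom (k f) = β
  edge f g : S.IsBranch gr γ f → S.IsBranch gr γ g → S.BranchEdge gr f g →
    S.BranchEdge gr (k f) (k g)

variable {S} {n : ℕ} [Nonempty V] [hS : Fact S.ModelsGBAC]

section Def

variable {t u : (Fin n → V) → V} [S.DefFun t] [S.DefFun u]

instance DefFun.inter : S.DefFun fun v => S.inter (t v) (u v) :=
  comp₂ (f := S.inter) (by unfold SecondOrderStructure.inter; infer_instance)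

instance DefPred.isPoint : S.DefPred fun v => S.IsPoint (t v) (u v) :=
  comp₂ (P := S.IsPoint) (by unfold IsPoint; infer_instance)

instance DefFun.trunc : S.DefFun fun v => S.trunc (t v) (u v) :=
  comp₂ (f := S.trunc) (by unfold SecondOrderStructure.trunc; infer_instance)

instance DefFun.restr : S.DefFun fun v => S.restr (t v) (u v) :=
  comp₂ (f := S.restr) (by unfold SecondOrderStructure.restr lam; infer_instance)

variable {gr : V → V} [hgr : S.DefFun fun v : Fin 1 → V => gr (v 0)]

instance DefPred.isSection : S.DefPred fun v => S.IsSection gr (t v) := by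
  have {n} {t : (Fin n → V) → V} [S.DefFun t] : S.DefFun fun v => gr (t v) := DefFun.comp₁ hgr
  exact DefPred.comp₁ (P := S.IsSection gr) (by unfold IsSection; infer_instance)

instance DefPred.isBranch : S.DefPred fun v => S.IsBranch gr (t v) (u v) :=
  comp₂ (P := S.IsBranch gr) (by unfold IsBranch; infer_instance)

instance DefPred.branchEdge : S.DefPred fun v => S.BranchEdge gr (t v) (u v) := by
  have {n} {t : (Fin n → V) → V} [S.DefFun t] : S.DefFun fun v => gr (t v) := DefFun.comp₁ hgr
  exact comp₂ (P := S.BranchEdge gr) (by unfold BranchEdge; infer_instance)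

end Def

theorem mem_inter {a b z : V} : S.mem z (S.inter a b) ↔ S.mem z a ∧ S.mem z b :=
  mem_collect ((small_mem a).mono fun _ h => h.1)

theorem IsOrdinal.inter_of_le {a b : V} (hb : S.IsOrdinal b) (h : S.mem a b ∨ a = b) :
    S.inter a b = a :=
  ext fun _ => mem_inter.trans (and_iff_left_of_imp fun hz => hb.subset_of_le h hz)

theorem IsOrdinal.inter_of_not_mem {a b : V} (ha : S.IsOrdinal a) (hb : S.IsOrdinal b)
    (h : ¬ S.mem a b) : S.inter a b = b :=
  ext fun _ => mem_inter.trans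
    (and_iff_right_of_imp fun hz => ha.subset_of_le (ha.not_mem hb h) hz)

theorem trunc_of_mem {β x : V} (h : S.mem (S.rank x) β) : S.trunc β x = x := by
  simp [trunc, h, collect_mem]

theorem trunc_of_not_mem {β x : V} (h : ¬ S.mem (S.rank x) β) : S.trunc β x = β := by
  simp [trunc, h, collect_mem]

theorem rank_trunc {β x : V} (hβ : S.IsOrdinal β) :
    S.rank (S.trunc β x) = S.inter (S.rank x) β := by
  by_cases h : S.mem (S.rank x) β
  · rw [trunc_of_mem h, hβ.inter_of_le (Or.inl h)]
  · rw [trunc_of_not_mem h, (isOrdinal_rank x).inter_of_not_mem hβ h, hβ.rank_eq]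

theorem isPoint_trunc {β x : V} : S.IsPoint β (S.trunc β x) := by
  by_cases h : S.mem (S.rank x) β
  · rw [trunc_of_mem h]; exact Or.inl h
  · rw [trunc_of_not_mem h]; exact Or.inr rfl

theorem IsPoint.rank_le {β x : V} (hβ : S.IsOrdinal β) (h : S.IsPoint β x) :
    S.mem (S.rank x) β ∨ S.rank x = β := by
  rcases h with h | rfl
  exacts [Or.inl h, Or.inr hβ.rank_eq]

section Sections

variable {gr : V → V} {β γ f g : V}

theorem isSection_lam {δ : V} (e : V → V) [S.DefFun fun v : Fin 1 → V => e (v 0)]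
    (h : ∀ ξ, S.mem ξ δ → S.mem (e ξ) (S.fst (gr (S.succ ξ)))) : S.IsSection gr (S.lam δ e) := by
  constructor
  · intro p
    rw [mem_lam, dom_lam]
    exact exists_congr fun ξ => and_congr_right fun hξ => by rw [app_lam hξ]
  · intro ξ hξ
    rw [dom_lam] at hξ
    rw [app_lam hξ]
    exact h ξ hξ

theorem IsSection.eq (hf : S.IsSection gr f) (hg : S.IsSection gr g) (hd : S.dom f = S.dom g)
    (h : ∀ ξ, S.mem ξ (S.dom f) → S.app f ξ = S.app g ξ) : f = g := by
  refine ext (S := S) fun p => ?_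
  rw [hf.1, hg.1, ← hd]
  exact exists_congr fun ξ => and_congr_right fun hξ => by rw [h ξ hξ]

theorem IsSection.app_eq (hf : S.IsSection gr f) {ξ y : V} (h : S.mem (S.pair ξ y) f) :
    S.mem ξ (S.dom f) ∧ S.app f ξ = y := by
  obtain ⟨ξ', hξ, e⟩ := (hf.1 _).1 h
  obtain ⟨rfl, rfl⟩ := pair_inj.1 e
  exact ⟨hξ, rfl⟩

theorem IsSection.isSection_restr (hf : S.IsSection gr f) : S.IsSection gr (S.restr β f) :=
  isSection_lam _ fun ξ hξ => hf.2 ξ (mem_inter.1 hξ).1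

theorem dom_restr : S.dom (S.restr β f) = S.inter (S.dom f) β := dom_lam

theorem app_restr {ξ : V} (h : S.mem ξ (S.dom f)) (h' : S.mem ξ β) :
    S.app (S.restr β f) ξ = S.app f ξ :=
  app_lam (mem_inter.2 ⟨h, h'⟩)

theorem IsBranch.isOrdinal_dom (hβ : S.IsOrdinal β) (hf : S.IsBranch gr β f) :
    S.IsOrdinal (S.dom f) := by
  rcases hf.2 with h | h
  · exact hβ.of_mem h
  · rwa [h]

theorem rank_lt_of_mem_fst {G v : V} (h : S.mem v (S.fst G)) (hG : S.IsGraph G) :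
    S.mem (S.rank v) (S.rank G) := by
  have e := isPair_iff.1 (isGraph_iff.1 hG).1
  have ho := isOrdinal_rank (S := S) G
  have h1 : S.mem (S.rank (S.pair (S.fst G) (S.snd G))) (S.succ (S.rank G)) := by
    rw [← e]; exact self_mem_succ _
  exact ho.subset_of_le (mem_succ.1 (rank_lt_of_pair ho.succ h1).1) (rank_lt_of_mem h)

/-- This is the purpose of closed points: ξ + 1 < β, so the vertices of `gr (ξ + 1)` have rank below
β. Entries of a branch below β are therefore themselves points. -/
theorem IsSection.rank_pair_lt (hd : S.IsDescending gr) (hβ : S.IsClosedPoint gr β)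
    (hf : S.IsSection gr f) {ξ : V} (hξ : S.mem ξ (S.dom f)) (hξβ : S.mem ξ β) :
    S.mem (S.rank (S.pair ξ (S.app f ξ))) β := by
  have hs := hβ.succClosed ξ hξβ
  refine SecondOrderStructure.rank_pair_lt hβ.isOrdinal hβ.succClosed ?_ ?_
  · rwa [(hβ.isOrdinal.of_mem hξβ).rank_eq]
  · exact hβ.isOrdinal.trans
      (rank_lt_of_mem_fst (hf.2 ξ hξ) (hd.isGraph _ (hβ.isOrdinal.of_mem hs))) (hβ.rank_lt _ hs)

theorem small_isPoint (hβ : S.IsOrdinal β) : S.Small (S.IsPoint β) :=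
  (small_rank_lt hβ).or (small_singleton β)

theorem small_isBranch [hgr : S.DefFun fun v : Fin 1 → V => gr (v 0)] (hd : S.IsDescending gr)
    (hβ : S.IsClosedPoint gr β) : S.Small (S.IsBranch gr β) := by
  refine (small_rank_lt hβ.isOrdinal).subset.mono fun f hf p hp => ?_
  obtain ⟨ξ, hξ, rfl⟩ := (hf.1.1 p).1 hp
  exact hf.1.rank_pair_lt hd hβ hξ (hβ.isOrdinal.subset_of_le hf.2 hξ)

/-- Truncation and restriction respect all relations. -/
theorem isPointMap_trunc (hd : S.IsDescending gr) (hβ : S.IsClosedPoint gr β)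
    (hγ : S.IsClosedPoint gr γ) (hle : S.mem β γ ∨ β = γ) :
    S.IsPointMap gr γ β (S.trunc β) (S.restr β) := by
  have oβ := hβ.isOrdinal
  have oγ := hγ.isOrdinal
  have hγβ : ¬ S.mem (S.rank γ) β := by
    rw [oγ.rank_eq]
    exact fun h => mem_irrefl _ (oγ.subset_of_le hle h)
  have hne {x : V} (h : S.mem (S.rank x) β) : x ≠ γ := by
    rintro rfl; exact hγβ h
  refine ⟨fun x _ => isPoint_trunc, fun f hf => ⟨hf.1.isSection_restr, ?_⟩, fun x y _ _ h => ?_,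
    fun x y _ _ h => ?_, fun f x hf hx h => ?_, fun x f hx hf h => ?_, fun f g hf hg h => ?_⟩
  · rw [dom_restr]
    by_cases h : S.mem (S.dom f) β
    · rw [oβ.inter_of_le (Or.inl h)]; exact Or.inl h
    · exact Or.inr ((hf.isOrdinal_dom oγ).inter_of_not_mem oβ h)
  · by_cases hy : S.mem (S.rank y) β
    · have hxy := h.resolve_right (hne hy)
      rw [trunc_of_mem hy, trunc_of_mem (oβ.trans (rank_lt_of_mem hxy) hy)]
      exact Or.inl hxy
    · exact Or.inr (trunc_of_not_mem hy)
  · by_cases hy : S.mem (S.rank y) β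
    · have hxy := h.resolve_right (hne hy)
      rw [trunc_of_mem hy]
      by_cases hx : S.mem (S.rank x) β
      · rw [trunc_of_mem hx]; exact Or.inl hxy
      · rw [trunc_of_not_mem hx]
        refine Or.inl fun hc => ?_
        have := rank_lt_of_mem hc
        rw [oβ.rank_eq] at this
        exact mem_asymm this hy
    · exact Or.inr (trunc_of_not_mem hy)
  · rw [dom_restr, rank_trunc oβ, h]
  · have od := hf.isOrdinal_dom oγ
    by_cases hxβ : S.mem (S.rank x) β
    · have hxf := h.resolve_right fun hc => hne hxβ hc.1
      rw [trunc_of_mem hxβ]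
      obtain ⟨ξ, hξ, rfl⟩ := (hf.1.1 x).1 hxf
      have hξβ := (rank_lt_of_pair oβ hxβ).1
      rw [(od.of_mem hξ).rank_eq] at hξβ
      exact Or.inl (mem_lam.2 ⟨ξ, mem_inter.2 ⟨hξ, hξβ⟩, rfl⟩)
    · rw [trunc_of_not_mem hxβ, dom_restr]
      -- A branch of length below β has all its entries in V_β, so an entry outside V_β forces the
      -- restriction to have full length β.
      refine Or.inr ⟨rfl, od.inter_of_not_mem oβ fun hc => ?_⟩
      rcases h with h | ⟨-, h⟩
      · obtain ⟨ξ, hξ, rfl⟩ := (hf.1.1 x).1 h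
        exact hxβ (hf.1.rank_pair_lt hd hβ hξ (oβ.trans hξ hc))
      · rw [h] at hc
        exact hγβ (by rwa [oγ.rank_eq])
  · refine ⟨by rw [dom_restr, dom_restr, h.1], fun ξ hξ => ?_⟩
    rw [dom_restr, mem_inter] at hξ
    rw [app_restr hξ.1 hξ.2, app_restr (h.1 ▸ hξ.1) hξ.2]
    exact h.2 ξ hξ.1

end Sections

/-! ### Rigidity: maps are truncations and restrictions -/

section Rigidity

variable {gr : V → V} [hgr : S.DefFun fun v : Fin 1 → V => gr (v 0)] {β γ : V} {j k : V → V}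
  [hj : S.DefFun fun v : Fin 1 → V => j (v 0)] [hk : S.DefFun fun v : Fin 1 → V => k (v 0)]

/-- A point of rank `κ < β` cannot be sent to a point of larger rank, since otherwise there would be
a homomorphism from `gr κ` to `gr (κ + 1)`. -/
theorem IsPointMap.not_rank_lt (h : S.IsPointMap gr γ β j k) (hd : S.IsDescending gr)
    (hγ : S.IsOrdinal γ) {x : V} (hx : S.IsPoint γ x) :
    ¬ S.mem (S.rank x) (S.rank (j x)) := by
  intro hlt
  have {n} {t : (Fin n → V) → V} [S.DefFun t] : S.DefFun fun v => gr (t v) := DefFun.comp₁ hgr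
  have {n} {t : (Fin n → V) → V} [S.DefFun t] : S.DefFun fun v => k (t v) := DefFun.comp₁ hk
  set κ := S.rank x with hκ
  have oκ : S.IsOrdinal κ := isOrdinal_rank x
  have hle (ξ : V) (hξ : S.mem ξ κ) : S.mem (S.succ ξ) κ ∨ S.succ ξ = κ := by
    refine (oκ.of_mem hξ).succ.le_of_subset oκ fun z hz => ?_
    rcases mem_succ.1 hz with h | rfl
    exacts [oκ.trans h hξ, hξ]
  have os (ξ : V) (hξ : S.mem ξ κ) : S.IsOrdinal (S.succ ξ) := (oκ.of_mem hξ).succ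
  -- Since ξ + 1 ≤ κ, descent provides homomorphisms to each `gr (ξ + 1)`. The shift by one leaves
  -- coordinate κ for `gr (κ + 1)`, which `gr κ` cannot reach.
  obtain ⟨H, hH, hhom⟩ := exists_choice (S := S) (a := κ)
    (fun ξ f => S.IsHom (gr κ) (gr (S.succ ξ)) f)
    (fun ξ hξ => small_isHom (hd.isGraph _ oκ) (hd.isGraph _ (os ξ hξ)))
    (fun ξ hξ => hd.exists_hom _ _ (os ξ hξ) oκ (hle ξ hξ))
  have {n} {t : (Fin n → V) → V} [S.DefFun t] : S.DefFun fun v => H (t v) := DefFun.comp₁ hH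
  have hhom' (ξ : V) (hξ : S.mem ξ κ) := (isHom_iff (hd.isGraph _ oκ)
    (hd.isGraph _ (os ξ hξ))).1 (hhom ξ hξ)
  let F : V → V := fun v => S.lam κ fun ξ => S.app (H ξ) v
  have defF {n} {t : (Fin n → V) → V} [S.DefFun t] : S.DefFun fun v => F (t v) :=
    DefFun.comp₁ (f := F) (by simp only [F, lam]; infer_instance)
  have hF (v : V) (hv : S.mem v (S.fst (gr κ))) : S.IsBranch gr γ (F v) := by
    refine ⟨isSection_lam _ fun ξ hξ => (hhom' ξ hξ).1.app_mem hv, ?_⟩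
    rw [dom_lam]
    exact hx.rank_le hγ
  -- The length of `F v` is the rank of x, so the length of its image is the rank of `j x`, which
  -- exceeds κ.
  have hdom (v : V) (hv : S.mem v (S.fst (gr κ))) : S.mem κ (S.dom (k (F v))) := by
    rw [h.dom (F v) x (hF v hv) hx dom_lam]
    exact hlt
  have gκ := hd.isGraph _ oκ
  have gκ' := hd.isGraph _ oκ.succ
  refine hd.no_hom κ (S.succ κ) oκ oκ.succ (self_mem_succ κ)
    ⟨S.lam (S.fst (gr κ)) fun v => S.app (k (F v)) κ, (isHom_iff gκ gκ').2
    ⟨isFunction_lam fun v hv => ?_, fun v w hvw => ?_⟩⟩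
  · exact (h.isBranch _ (hF v hv)).1.2 κ (hdom v hv)
  · obtain ⟨hv, hw⟩ := gκ.mem_of_edge hvw
    rw [app_lam hv, app_lam hw]
    refine (h.edge _ _ (hF v hv) (hF w hw) ⟨by simp only [F, dom_lam], fun ξ hξ => ?_⟩).2 κ
      (hdom v hv)
    simp only [F, dom_lam] at hξ
    simp only [F, app_lam hξ]
    exact (hhom' ξ hξ).2 v w hvw

/-- The wild card relates γ to itself, and only the top point can be the image, since no set is a
member of itself. -/
theorem IsPointMap.apply_top (h : S.IsPointMap gr γ β j k) : j γ = β := by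
  have hγ : S.IsPoint γ γ := Or.inr rfl
  exact (h.mem γ γ hγ hγ (Or.inr rfl)).resolve_left (mem_irrefl _)

/-- Induction on rank. If x has rank below β, then `j x` has no larger rank, so all members of x and
of `j x` are fixed; the two membership relations then make x and `j x` equal. If x has rank at least
β but `j x` were not β, then x would be a subset of `j x`, an element of V_β. -/
theorem IsPointMap.eq_trunc (h : S.IsPointMap gr γ β j k) (hd : S.IsDescending gr)
    (hβ : S.IsOrdinal β) (hγ : S.IsOrdinal γ) {x : V} (hx : S.IsPoint γ x) : j x = S.trunc β x := by
  have {n} {t : (Fin n → V) → V} [S.DefFun t] : S.DefFun fun v => j (t v) := DefFun.comp₁ hj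
  have key (κ : V) : ∀ x, S.IsPoint γ x → S.rank x = κ → j x = S.trunc β x := by
    refine mem_induction (S := S) (P := fun κ => ∀ x, S.IsPoint γ x → S.rank x = κ →
      j x = S.trunc β x) (fun κ ih x hx e => ?_) κ
    subst e
    have ih (y : V) (hy : S.mem (S.rank y) (S.rank x)) : S.IsPoint γ y ∧ j y = S.trunc β y := by
      have : S.IsPoint γ y := Or.inl (hγ.subset_of_le (hx.rank_le hγ) hy)
      exact ⟨this, ih _ hy y this rfl⟩
    by_contra hne
    by_cases hxβ : S.mem (S.rank x) β
    · rw [trunc_of_mem hxβ] at hne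
      have hnlt := h.not_rank_lt hd hγ hx
      have hjβ : j x ≠ β := by
        intro e
        rw [e, hβ.rank_eq] at hnlt
        exact hnlt hxβ
      have hid (y : V) (hy : S.mem (S.rank y) (S.rank x)) : j y = y := by
        rw [(ih y hy).2, trunc_of_mem (hβ.trans hy hxβ)]
      refine hne (ext (S := S) fun y => ⟨fun hy => ?_, fun hy => ?_⟩)
      · have hy' := (isOrdinal_rank x).subset_of_le
          ((isOrdinal_rank x).not_mem (isOrdinal_rank (j x)) hnlt) (rank_lt_of_mem hy)
        by_contra hyx
        have := (h.not_mem y x (ih y hy').1 hx (Or.inl hyx)).resolve_right hjβ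
        rw [hid y hy'] at this
        exact this hy
      · have hy' := rank_lt_of_mem hy
        have := (h.mem y x (ih y hy').1 hx (Or.inl hy)).resolve_right hjβ
        rwa [hid y hy'] at this
    · rw [trunc_of_not_mem hxβ] at hne
      have hjx : S.mem (S.rank (j x)) β := (h.isPoint x hx).resolve_right hne
      have hsub (y : V) (hy : S.mem y x) : S.mem y (j x) := by
        have hy' := ih y (rank_lt_of_mem hy)
        have := (h.mem y x hy'.1 hx (Or.inl hy)).resolve_right hne
        rw [hy'.2] at this
        by_cases hyβ : S.mem (S.rank y) β
        · rwa [trunc_of_mem hyβ] at this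
        · rw [trunc_of_not_mem hyβ] at this
          have := rank_lt_of_mem this
          rw [hβ.rank_eq] at this
          exact absurd hjx (mem_asymm this)
      exact hxβ (rank_lt_of_subset hβ hsub hjx)
  exact key _ x hx rfl

/-- If γ < β, truncation at β fixes γ, while the top γ must go to the top β. -/
theorem IsPointMap.le (h : S.IsPointMap gr γ β j k) (hd : S.IsDescending gr)
    (hβ : S.IsOrdinal β) (hγ : S.IsOrdinal γ) : ¬ S.mem γ β := by
  intro hlt
  have := h.eq_trunc hd hβ hγ (x := γ) (Or.inr rfl)
  rw [h.apply_top, trunc_of_mem (by rwa [hγ.rank_eq])] at this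
  rw [this] at hlt
  exact mem_irrefl _ hlt

/-- The length is determined by the image of the point `dom f`. Each pair (ξ, f ξ) with ξ < β is a
point of V_β, fixed by j, so it lies in `k f`. -/
theorem IsPointMap.eq_restr (h : S.IsPointMap gr γ β j k) (hd : S.IsDescending gr)
    (hβ : S.IsClosedPoint gr β) (hγ : S.IsOrdinal γ) {f : V} (hf : S.IsBranch gr γ f) :
    k f = S.restr β f := by
  have oβ := hβ.isOrdinal
  have od := hf.isOrdinal_dom hγ
  have hδ : S.IsPoint γ (S.dom f) := by
    refine hf.2.imp (fun h => ?_) id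
    rwa [od.rank_eq]
  have hdom : S.dom (k f) = S.dom (S.restr β f) := by
    rw [h.dom f (S.dom f) hf hδ od.rank_eq.symm, h.eq_trunc hd oβ hγ hδ, rank_trunc oβ, od.rank_eq,
      dom_restr]
  have hkf := (h.isBranch f hf).1
  refine hkf.eq hf.1.isSection_restr hdom fun ξ hξ => ?_
  rw [hdom, dom_restr, mem_inter] at hξ
  rw [app_restr hξ.1 hξ.2]
  have hp := hf.1.rank_pair_lt hd hβ hξ.1 hξ.2
  have hpγ : S.IsPoint γ (S.pair ξ (S.app f ξ)) :=
    Or.inl (hγ.subset_of_le (hγ.not_mem oβ (h.le hd oβ hγ)) hp)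
  have := h.mem_branch _ f hpγ hf (Or.inl ((hf.1.1 _).2 ⟨ξ, hξ.1, rfl⟩))
  rw [h.eq_trunc hd oβ hγ hpγ, trunc_of_mem hp] at this
  refine (hkf.app_eq (this.resolve_right fun hc => ?_)).2
  rw [hc.1, oβ.rank_eq] at hp
  exact mem_irrefl _ hp

end Rigidity

end

/-! ### The rigid graphs -/

section
variable {V : Type u} (S : SecondOrderStructure V)

/-- The least closed point above `α`. -/
noncomputable def closedPoint [Nonempty V] (gr : V → V) (α : V) : V :=
  S.collect fun z => ∀ β, S.IsClosedPoint gr β ∧ S.mem α β → S.mem z β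

/-- The sorts of vertices: three copies of the points, two copies of the branches, and five
markers. -/
abbrev VertexSort : Type := Fin 5 ⊕ Fin 5

/-- Which sorts may be joined by an edge. -/
def sortEdge : VertexSort → VertexSort → Bool
  | .inl i, .inl j =>
    (i, j) ∈ ([(0, 1), (1, 0), (0, 2), (2, 0), (3, 4), (4, 3), (3, 0), (0, 3)] :
      List (Fin 5 × Fin 5))
  | .inl i, .inr j => i = j ∨ (i = 1 ∧ j = 0)
  | .inr i, .inl j => i = j
  | .inr i, .inr j => i < j

set_option synthInstance.maxHeartbeats 400000 in
set_option synthInstance.maxSize 4000 in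
set_option maxRecDepth 100000 in
-- The markers are the only transitive tournament on five sorts, so a homomorphism must fix them in
-- order.
theorem eq_markers_of_sortEdge : ∀ a b, sortEdge a b → ∀ c, sortEdge a c ∧ sortEdge b c →
    ∀ d, sortEdge a d ∧ sortEdge b d ∧ sortEdge c d →
    ∀ e, sortEdge a e ∧ sortEdge b e ∧ sortEdge c e ∧ sortEdge d e →
    a = .inr 0 ∧ b = .inr 1 ∧ c = .inr 2 ∧ d = .inr 3 ∧ e = .inr 4 := by
  decide +kernel

/-- Arrows in both directions identify the sort attached to a marker; the additional arrow from sort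
1 to marker 0 goes one way only. -/
theorem eq_inl_of_sortEdge : ∀ (a : VertexSort) (i : Fin 5), sortEdge a (.inr i) →
    sortEdge (.inr i) a → a = .inl i := by
  decide +kernel

/-- The vertices of each sort in the rigid graph with closed point `β`. -/
def rigidVertex [Nonempty V] (gr : V → V) (β : V) : VertexSort → V → Prop
  | .inl i => fun x => (i = 0 ∨ i = 1 ∨ i = 2) ∧ S.IsPoint β x ∨ (i = 3 ∨ i = 4) ∧ S.IsBranch gr β x
  | .inr _ => fun x => x = Classical.arbitrary V

/-- The edges between the sorts in the rigid graph with index `α` and closed point `β`. -/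
def rigidEdge [Nonempty V] (gr : V → V) (α β : V) : VertexSort → VertexSort → V → V → Prop
  | .inl i, .inl j => fun x y =>
    -- Identity edges tie the copies together, and the returning edges carry one relation each, so
    -- the pair of sorts tells which relation an edge encodes.
    (i = 0 ∧ j = 1 ∧ x = y) ∨ (i = 1 ∧ j = 0 ∧ (S.mem x y ∨ y = β)) ∨
    (i = 0 ∧ j = 2 ∧ x = y) ∨ (i = 2 ∧ j = 0 ∧ (¬ S.mem x y ∨ y = β)) ∨
    (i = 3 ∧ j = 4 ∧ x = y) ∨ (i = 4 ∧ j = 3 ∧ S.BranchEdge gr x y) ∨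
    (i = 3 ∧ j = 0 ∧ S.dom x = S.rank y) ∨
    (i = 0 ∧ j = 3 ∧ (S.mem x y ∨ x = β ∧ S.dom y = β))
  -- Among the edges, only this clause involves α itself; it is needed because different indices may
  -- share a closed point.
  | .inl i, .inr j => fun x _ => i = j ∨ i = 1 ∧ j = 0 ∧ ¬ S.mem (S.rank x) α
  | .inr i, .inl j => fun _ _ => i = j
  | .inr i, .inr j => fun _ _ => i < j

/-- The rigid graph with index `α`. -/
noncomputable def rigidGraph [Nonempty V] (gr : V → V) (c : VertexSort → V) (α : V) : V :=
  S.taggedGraph c (S.rigidVertex gr (S.closedPoint gr α))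
    (S.rigidEdge gr α (S.closedPoint gr α))

/-- The canonical homomorphism between rigid graphs, on each sort. -/
noncomputable def rigidMap [Nonempty V] (β : V) : VertexSort → V → V
  | .inl i => fun x => if i = 0 ∨ i = 1 ∨ i = 2 then S.trunc β x else S.restr β x
  | .inr _ => fun x => x

variable {S} {n : ℕ} [Nonempty V] [hS : Fact S.ModelsGBAC]

section Def

variable {t u w : (Fin n → V) → V} [S.DefFun t] [S.DefFun u] [S.DefFun w]
  {gr : V → V} [hgr : S.DefFun fun v : Fin 1 → V => gr (v 0)]

instance DefPred.isClosedPoint : S.DefPred fun v => S.IsClosedPoint gr (t v) := by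
  have {n} {t : (Fin n → V) → V} [S.DefFun t] : S.DefFun fun v => gr (t v) := DefFun.comp₁ hgr
  have : S.DefPred fun v : Fin 1 → V => S.IsOrdinal (v 0) ∧ S.SuccClosed (v 0) ∧
      ∀ ξ, S.mem ξ (v 0) → S.mem (S.rank (gr ξ)) (v 0) := by
    unfold SuccClosed; infer_instance
  exact comp₁ (P := S.IsClosedPoint gr) (this.of_iff fun v =>
    ⟨fun h => ⟨h.1, h.2, h.3⟩, fun h => ⟨h.1, h.2.1, h.2.2⟩⟩)

instance DefFun.closedPoint : S.DefFun fun v => S.closedPoint gr (t v) :=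
  comp₁ (f := S.closedPoint gr) (by unfold SecondOrderStructure.closedPoint; infer_instance)

instance DefPred.rigidVertex (i : VertexSort) : S.DefPred fun v => S.rigidVertex gr (t v) i (u v) := by
  rcases i with i | i <;> simp only [SecondOrderStructure.rigidVertex] <;> infer_instance

instance DefPred.rigidEdge (i j : VertexSort) :
    S.DefPred fun v => S.rigidEdge gr (t v) (S.closedPoint gr (t v)) i j (u v) (w v) := by
  rcases i with i | i <;> rcases j with j | j <;>
    simp only [SecondOrderStructure.rigidEdge] <;> infer_instance

instance DefFun.rigidGraph (c : VertexSort → V) : S.DefFun fun v => S.rigidGraph gr c (t v) :=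
  comp₁ (f := S.rigidGraph gr c)
    (by unfold SecondOrderStructure.rigidGraph taggedGraph; infer_instance)

instance DefFun.rigidMap (β : V) (i : VertexSort) : S.DefFun fun v => S.rigidMap β i (t v) := by
  rcases i with i | i <;> simp only [SecondOrderStructure.rigidMap]
  · split_ifs <;> infer_instance
  · infer_instance

end Def

section ClosedPoint

variable {gr : V → V} [hgr : S.DefFun fun v : Fin 1 → V => gr (v 0)] {α α' : V}

theorem closedPoint_spec (hα : S.IsOrdinal α) :
    (S.IsClosedPoint gr (S.closedPoint gr α) ∧ S.mem α (S.closedPoint gr α)) ∧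
      ∀ β, S.IsClosedPoint gr β → S.mem α β → ∀ z, S.mem z (S.closedPoint gr α) → S.mem z β := by
  have {n} {t : (Fin n → V) → V} [S.DefFun t] : S.DefFun fun v => gr (t v) := DefFun.comp₁ hgr
  obtain ⟨δ, hδ, hαδ, hs, hr⟩ := exists_closed_above (fun ξ => S.rank (gr ξ))
    (fun ξ => isOrdinal_rank _) hα
  obtain ⟨β, hβ, hmin⟩ := exists_minimal (S := S) (P := fun β => S.IsClosedPoint gr β ∧ S.mem α β)
    inferInstance ⟨δ, ⟨hδ, hs, hr⟩, hαδ⟩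
  have hle (β') (h' : S.IsClosedPoint gr β' ∧ S.mem α β') (z : V) (hz : S.mem z β) : S.mem z β' :=
    h'.1.isOrdinal.subset_of_le
      (h'.1.isOrdinal.not_mem hβ.1.isOrdinal fun h => hmin β' h h') hz
  have key (z : V) : S.mem z β ↔ ∀ β, S.IsClosedPoint gr β ∧ S.mem α β → S.mem z β :=
    ⟨fun hz β' h' => hle β' h' z hz, fun h => h β hβ⟩
  have : S.closedPoint gr α = β := ext fun z => (mem_collect ⟨β, key⟩).trans (key z).symm
  rw [this]
  exact ⟨hβ, fun β' h h' => hle β' ⟨h, h'⟩⟩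

theorem closedPoint_mono (hα' : S.IsOrdinal α') (h : S.mem α α' ∨ α = α') :
    S.mem (S.closedPoint gr α) (S.closedPoint gr α') ∨
      S.closedPoint gr α = S.closedPoint gr α' := by
  have hα : S.IsOrdinal α := by
    rcases h with h | rfl
    exacts [hα'.of_mem h, hα']
  obtain ⟨⟨h1, h1'⟩, h2⟩ := closedPoint_spec (gr := gr) hα
  obtain ⟨⟨h3, h3'⟩, -⟩ := closedPoint_spec (gr := gr) hα'
  exact h1.isOrdinal.le_of_subset h3.isOrdinal
    (h2 _ h3 (h3.isOrdinal.lt_of_le_of_lt h h3'))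

end ClosedPoint

section Rigid

variable {gr : V → V} [hgr : S.DefFun fun v : Fin 1 → V => gr (v 0)] {c : VertexSort → V}
  {α α' : V}

theorem isTagged_rigid (hd : S.IsDescending gr) (hc : Function.Injective c) (hα : S.IsOrdinal α) :
    S.IsTagged c (S.rigidVertex gr (S.closedPoint gr α))
      (S.rigidEdge gr α (S.closedPoint gr α)) where
  injective := hc
  small i := by
    have hβ := (closedPoint_spec (gr := gr) hα).1.1
    rcases i with i | i
    · exact ((small_isPoint hβ.isOrdinal).or (small_isBranch hd hβ)).mono
        fun x hx => hx.imp And.right And.right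
    · exact small_singleton _
  vt_def i := inferInstance
  ed_def i j := inferInstance

theorem sortEdge_of_rigidEdge {β x y : V} {i j : VertexSort} (h : S.rigidEdge gr α β i j x y) :
    sortEdge i j := by
  rcases i with i | i <;> rcases j with j | j
  · rcases h with h | h | h | h | h | h | h | h <;> obtain ⟨rfl, rfl, -⟩ := h <;> decide
  · rcases h with rfl | ⟨rfl, rfl, -⟩
    · simp [sortEdge]
    · decide
  · simpa [sortEdge, rigidEdge] using h
  · simpa [sortEdge, rigidEdge] using h

theorem exists_isHom_rigidGraph (hd : S.IsDescending gr) (hc : Function.Injective c)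
    (hα' : S.IsOrdinal α') (h : S.mem α α' ∨ α = α') :
    ∃ f, S.IsHom (S.rigidGraph gr c α') (S.rigidGraph gr c α) f := by
  have hα : S.IsOrdinal α := by
    rcases h with h | rfl
    exacts [hα'.of_mem h, hα']
  obtain ⟨⟨hβ, hαβ⟩, -⟩ := closedPoint_spec (gr := gr) hα
  obtain ⟨⟨hγ, -⟩, -⟩ := closedPoint_spec (gr := gr) hα'
  have hm := isPointMap_trunc hd hβ hγ (closedPoint_mono hα' h)
  refine exists_isHom_taggedGraph (isTagged_rigid hd hc hα') (isTagged_rigid hd hc hα)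
    (S.rigidMap (S.closedPoint gr α)) (fun i => inferInstance) (fun i x hx => ?_)
    (fun i j x y hx hy he => ?_)
  · rcases i with i | i
    · rcases hx with ⟨hi, hx⟩ | ⟨hi, hx⟩
      · simp only [rigidMap, if_pos hi]
        exact Or.inl ⟨hi, hm.isPoint x hx⟩
      · have hi' : ¬ (i = 0 ∨ i = 1 ∨ i = 2) := by rcases hi with rfl | rfl <;> decide
        simp only [rigidMap, if_neg hi']
        exact Or.inr ⟨hi, hm.isBranch x hx⟩
    · exact hx
  · rcases i with i | i <;> rcases j with j | j
    · rcases he with h | h | h | h | h | h | h | h <;> obtain ⟨rfl, rfl, he⟩ := h <;>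
        simp [rigidVertex] at hx hy <;> simp [rigidMap, rigidEdge]
      · rw [he]
      · exact hm.mem x y hx hy he
      · rw [he]
      · exact hm.not_mem x y hx hy he
      · rw [he]
      · exact hm.edge x y hx hy he
      · exact hm.dom x y hx hy he
      · exact hm.mem_branch x y hx hy he
    · rcases he with rfl | ⟨rfl, rfl, he⟩
      · exact Or.inl rfl
      -- The image still has rank at least α: either x is unchanged and has rank at least α' ≥ α, or
      -- the image is the closed point, which exceeds α.
      · refine Or.inr ⟨rfl, rfl, fun hlt => he ?_⟩
        simp only [rigidMap, true_or, or_true, if_true] at hlt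
        by_cases hxβ : S.mem (S.rank x) (S.closedPoint gr α)
        · rw [trunc_of_mem hxβ] at hlt
          exact hα'.subset_of_le h hlt
        · rw [trunc_of_not_mem hxβ, hβ.isOrdinal.rank_eq] at hlt
          exact absurd hαβ (mem_asymm hlt)
    · exact he
    · exact he

/-- A homomorphism between rigid graphs preserves the sorts. -/
theorem exists_sort_map (hd : S.IsDescending gr) (hc : Function.Injective c)
    (hα : S.IsOrdinal α) (hα' : S.IsOrdinal α') {f : V}
    (hf : S.IsHom (S.rigidGraph gr c α') (S.rigidGraph gr c α) f) :
    ∀ i x, S.rigidVertex gr (S.closedPoint gr α') i x →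
      ∃ y, S.rigidVertex gr (S.closedPoint gr α) i y ∧
        S.app f (S.pair (c i) x) = S.pair (c i) y := by
  have hA := isTagged_rigid hd hc hα'
  have hB := isTagged_rigid hd hc hα
  have hmk (i : Fin 5) := isHom_taggedGraph_app (i := .inr i) (x := Classical.arbitrary V)
    hA hB hf rfl
  choose τ e hv hτ using hmk
  have hlt (i j : Fin 5) (hij : i < j) : sortEdge (τ i) (τ j) :=
    sortEdge_of_rigidEdge (isHom_taggedGraph_edge (i := .inr i) (j := .inr j) hA hB hf rfl rfl hij
      (hτ i) (hτ j))
  have hτ' (i : Fin 5) : τ i = .inr i := by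
    have := eq_markers_of_sortEdge _ _ (hlt 0 1 (by decide)) _
      ⟨hlt 0 2 (by decide), hlt 1 2 (by decide)⟩ _
      ⟨hlt 0 3 (by decide), hlt 1 3 (by decide), hlt 2 3 (by decide)⟩ _
      ⟨hlt 0 4 (by decide), hlt 1 4 (by decide), hlt 2 4 (by decide), hlt 3 4 (by decide)⟩
    fin_cases i
    exacts [this.1, this.2.1, this.2.2.1, this.2.2.2.1, this.2.2.2.2]
  intro i x hx
  rcases i with i | i
  · obtain ⟨k, y, hy, hxy⟩ := isHom_taggedGraph_app hA hB hf hx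
    have h1 := sortEdge_of_rigidEdge (isHom_taggedGraph_edge (i := .inl i) (j := .inr i) hA hB hf hx
      rfl (Or.inl rfl) hxy (hτ i))
    have h2 := sortEdge_of_rigidEdge (isHom_taggedGraph_edge (i := .inr i) (j := .inl i) hA hB hf
      rfl hx rfl (hτ i) hxy)
    rw [hτ'] at h1 h2
    obtain rfl := eq_inl_of_sortEdge _ _ h1 h2
    exact ⟨y, hy, hxy⟩
  · obtain rfl : x = Classical.arbitrary V := hx
    refine ⟨e i, ?_, ?_⟩
    · have := hv i
      rwa [hτ'] at this
    · rw [hτ, hτ']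

/-- Once sorts are preserved, the edges say that the induced maps on points and branches form an
`IsPointMap`, so rigidity determines every value. -/
theorem isHom_rigidGraph (hd : S.IsDescending gr) (hc : Function.Injective c)
    (hα : S.IsOrdinal α) (hα' : S.IsOrdinal α') {f : V}
    (hf : S.IsHom (S.rigidGraph gr c α') (S.rigidGraph gr c α) f) :
    ¬ S.mem α' α ∧ ∀ i x, S.rigidVertex gr (S.closedPoint gr α') i x →
      S.app f (S.pair (c i) x) = S.pair (c i) (S.rigidMap (S.closedPoint gr α) i x) := by
  obtain ⟨⟨hβ, hαβ⟩, -⟩ := closedPoint_spec (gr := gr) hα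
  obtain ⟨⟨hγ, hαγ⟩, -⟩ := closedPoint_spec (gr := gr) hα'
  have hA := isTagged_rigid hd hc hα'
  have hB := isTagged_rigid hd hc hα
  have hs := exists_sort_map hd hc hα hα' hf
  set β := S.closedPoint gr α with hβe
  set γ := S.closedPoint gr α' with hγe
  let φ : VertexSort → V → V := fun i x => S.snd (S.app f (S.pair (c i) x))
  have hφ (i : VertexSort) (x : V) (hx : S.rigidVertex gr γ i x) :
      S.rigidVertex gr β i (φ i x) ∧ S.app f (S.pair (c i) x) = S.pair (c i) (φ i x) := by
    obtain ⟨y, hy, e⟩ := hs i x hx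
    have : φ i x = y := by simp only [φ, e, snd_pair]
    rw [this]
    exact ⟨hy, e⟩
  have hedge {i j : VertexSort} {x y : V} (hx : S.rigidVertex gr γ i x)
      (hy : S.rigidVertex gr γ j y) (h : S.rigidEdge gr α' γ i j x y) :
      S.rigidEdge gr α β i j (φ i x) (φ j y) :=
    isHom_taggedGraph_edge hA hB hf hx hy h (hφ i x hx).2 (hφ j y hy).2
  have vp {δ x : V} {i : Fin 5} (hi : i = 0 ∨ i = 1 ∨ i = 2) :
      S.rigidVertex gr δ (.inl i) x ↔ S.IsPoint δ x := by
    rcases hi with rfl | rfl | rfl <;> simp [rigidVertex]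
  have vb {δ x : V} {i : Fin 5} (hi : i = 3 ∨ i = 4) :
      S.rigidVertex gr δ (.inl i) x ↔ S.IsBranch gr δ x := by
    rcases hi with rfl | rfl <;> simp [rigidVertex]
  have e01 {x : V} (hx : S.IsPoint γ x) : φ (.inl 1) x = φ (.inl 0) x := by
    have := hedge (i := .inl 0) (j := .inl 1) ((vp (by simp)).2 hx) ((vp (by simp)).2 hx)
      (by simp [rigidEdge])
    simpa [rigidEdge, eq_comm] using this
  have e02 {x : V} (hx : S.IsPoint γ x) : φ (.inl 2) x = φ (.inl 0) x := by
    have := hedge (i := .inl 0) (j := .inl 2) ((vp (by simp)).2 hx) ((vp (by simp)).2 hx)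
      (by simp [rigidEdge])
    simpa [rigidEdge, eq_comm] using this
  have e34 {x : V} (hx : S.IsBranch gr γ x) : φ (.inl 4) x = φ (.inl 3) x := by
    have := hedge (i := .inl 3) (j := .inl 4) ((vb (by simp)).2 hx) ((vb (by simp)).2 hx)
      (by simp [rigidEdge])
    simpa [rigidEdge, eq_comm] using this
  have hm : S.IsPointMap gr γ β (φ (.inl 0)) (φ (.inl 3)) := by
    refine ⟨fun x hx => ?_, fun g hg => ?_, fun x y hx hy h => ?_, fun x y hx hy h => ?_,
      fun g x hg hx h => ?_, fun x g hx hg h => ?_, fun g g' hg hg' h => ?_⟩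
    · exact (vp (by simp)).1 (hφ (.inl 0) x ((vp (by simp)).2 hx)).1
    · exact (vb (by simp)).1 (hφ (.inl 3) g ((vb (by simp)).2 hg)).1
    · have := hedge (i := .inl 1) (j := .inl 0) ((vp (by simp)).2 hx) ((vp (by simp)).2 hy)
        (by simpa [rigidEdge] using h)
      rw [e01 hx] at this
      simpa [rigidEdge] using this
    · have := hedge (i := .inl 2) (j := .inl 0) ((vp (by simp)).2 hx) ((vp (by simp)).2 hy)
        (by simpa [rigidEdge] using h)
      rw [e02 hx] at this
      simpa [rigidEdge] using this
    · have := hedge (i := .inl 3) (j := .inl 0) ((vb (by simp)).2 hg) ((vp (by simp)).2 hx)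
        (by simpa [rigidEdge] using h)
      simpa [rigidEdge] using this
    · have := hedge (i := .inl 0) (j := .inl 3) ((vp (by simp)).2 hx) ((vb (by simp)).2 hg)
        (by simpa [rigidEdge] using h)
      simpa [rigidEdge] using this
    · have := hedge (i := .inl 4) (j := .inl 3) ((vb (by simp)).2 hg) ((vb (by simp)).2 hg')
        (by simpa [rigidEdge] using h)
      rw [e34 hg] at this
      simpa [rigidEdge] using this
  have h0 {x : V} (hx : S.IsPoint γ x) : φ (.inl 0) x = S.trunc β x :=
    hm.eq_trunc hd hβ.isOrdinal hγ.isOrdinal hx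
  have h3 {x : V} (hx : S.IsBranch gr γ x) : φ (.inl 3) x = S.restr β x :=
    hm.eq_restr hd hβ hγ.isOrdinal hx
  refine ⟨fun hlt => ?_, fun i x hx => ?_⟩
  · have hγβ : S.mem γ β ∨ γ = β := closedPoint_mono hα (Or.inl hlt)
    -- The closed points coincide, so the point α' is fixed. It has the edge to marker 0 in the
    -- graph of index α', but not in that of α, as its rank α' is below α.
    have hγβ := hγβ.resolve_left (hm.le hd hβ.isOrdinal hγ.isOrdinal)
    have hp : S.IsPoint γ α' := Or.inl (by rwa [hα'.rank_eq])
    have := hedge (i := .inl 1) (j := .inr 0) ((vp (by simp)).2 hp) rfl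
      (Or.inr ⟨rfl, rfl, by rw [hα'.rank_eq]; exact mem_irrefl _⟩)
    rw [e01 hp, h0 hp, trunc_of_mem (by rw [hα'.rank_eq, ← hγβ]; exact hαγ)] at this
    simp only [rigidEdge, hα'.rank_eq, hlt] at this
    simp at this
  · rw [(hφ i x hx).2]
    congr 1
    rcases i with i | i
    · rcases hx with ⟨hi, hx⟩ | ⟨hi, hx⟩
      · simp only [rigidMap, if_pos hi, ← h0 hx]
        rcases hi with rfl | rfl | rfl
        exacts [rfl, e01 hx, e02 hx]
      · have hi' : ¬ (i = 0 ∨ i = 1 ∨ i = 2) := by rcases hi with rfl | rfl <;> decide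
        simp only [rigidMap, if_neg hi', ← h3 hx]
        rcases hi with rfl | rfl
        exacts [rfl, e34 hx]
    · exact (hφ (.inr i) x hx).1.trans hx.symm

end Rigid

/-! ### From a failure of SWVP to a failure of WVP -/

theorem exists_isDescending {F : Set V} (hF : S.IsOrdSequenceOfGraphs F)
    (hhom : ∀ α β, S.IsOrdinal α → S.IsOrdinal β → S.mem α β ∨ α = β →
      ∀ Gα Gβ, S.ClassRel F α Gα → S.ClassRel F β Gβ → ∃ h, S.IsHom Gβ Gα h)
    (hno : ∀ α β, S.IsOrdinal α → S.IsOrdinal β → S.mem α β →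
      ∀ Gα Gβ, S.ClassRel F α Gα → S.ClassRel F β Gβ → ¬ ∃ h, S.IsHom Gα Gβ h) :
    ∃ gr : V → V, (S.DefFun fun v : Fin 1 → V => gr (v 0)) ∧ S.IsDescending gr := by
  obtain ⟨hc, hp, hu⟩ := hF
  have : S.IsClass F := ⟨hc⟩
  -- Collecting the members of the unique value turns the class relation into a total definable
  -- function; its values off the ordinals play no role.
  have hgr (α : V) (hα : S.IsOrdinal α) :
      S.ClassRel F α (S.collect fun z => ∃ G, S.ClassRel F α G ∧ S.mem z G) := by
    obtain ⟨G, hG, hG'⟩ := hu α hα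
    have (G' : V) : S.ClassRel F α G' ↔ G' = G := ⟨hG' G', by rintro rfl; exact hG⟩
    simp only [this, exists_eq_left, collect_mem]
  refine ⟨fun α => S.collect fun z => ∃ G, S.ClassRel F α G ∧ S.mem z G, inferInstance,
    fun ξ hξ => ?_, fun ξ η hξ hη h => hhom ξ η hξ hη h _ _ (hgr ξ hξ) (hgr η hη),
    fun ξ η hξ hη h => hno ξ η hξ hη h _ _ (hgr ξ hξ) (hgr η hη)⟩
  obtain ⟨α, G, -, hG, e⟩ := hp _ (classRel_iff.1 (hgr ξ hξ))
  have := (pair_inj.1 (isPair_iff.1 e)).2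
  exact this ▸ hG

theorem not_weakVopenkaPrinciple {gr : V → V} [hgr : S.DefFun fun v : Fin 1 → V => gr (v 0)]
    (hd : S.IsDescending gr) : ¬ S.WeakVopenkaPrinciple := by
  obtain ⟨c₀, hc₀⟩ := exists_injective_nat S
  let c : VertexSort → V := fun i => c₀ (Encodable.encode i)
  have hc : Function.Injective c := hc₀.comp Encodable.encode_injective
  have hrel {α G : V} : S.ClassRel {p | ∃ α, S.IsOrdinal α ∧ p = S.pair α (S.rigidGraph gr c α)} α G ↔
      S.IsOrdinal α ∧ G = S.rigidGraph gr c α := by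
    rw [classRel_iff]
    constructor
    · rintro ⟨α', hα', e⟩
      obtain ⟨rfl, rfl⟩ := pair_inj.1 e
      exact ⟨hα', rfl⟩
    · rintro ⟨hα, rfl⟩
      exact ⟨α, hα, rfl⟩
  refine not_not.2 ⟨{p | ∃ α, S.IsOrdinal α ∧ p = S.pair α (S.rigidGraph gr c α)},
    ⟨?_, ?_, fun α hα => ?_⟩, fun α β hα hβ h Gα Gβ hGα hGβ => ?_,
    fun α β hα hβ h Gα Gβ hGα hGβ => ?_⟩
  · exact (isClass_setOf (S := S)
      (P := fun p => ∃ α, S.IsOrdinal α ∧ p = S.pair α (S.rigidGraph gr c α)) inferInstance).out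
  · rintro p ⟨α, hα, rfl⟩
    exact ⟨α, _, hα, (isTagged_rigid hd hc hα).isGraph, isPair_pair _ _⟩
  · exact ⟨_, hrel.2 ⟨hα, rfl⟩, fun G hG => (hrel.1 hG).2⟩
  · obtain ⟨-, rfl⟩ := hrel.1 hGα
    obtain ⟨-, rfl⟩ := hrel.1 hGβ
    obtain ⟨f, hf⟩ := exists_isHom_rigidGraph hd hc hβ h
    refine ⟨f, hf, fun f' hf' => ?_⟩
    refine isHom_taggedGraph_ext (isTagged_rigid hd hc hβ) (isTagged_rigid hd hc hα) hf' hf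
      fun i x hx => ?_
    rw [(isHom_rigidGraph hd hc hα hβ hf).2 i x hx, (isHom_rigidGraph hd hc hα hβ hf').2 i x hx]
  · obtain ⟨-, rfl⟩ := hrel.1 hGα
    obtain ⟨-, rfl⟩ := hrel.1 hGβ
    rintro ⟨f, hf⟩
    exact (isHom_rigidGraph hd hc hβ hα hf).1 h

end

end SecondOrderStructure

theorem mainTheorem1 {V : Type*} (S : SecondOrderStructure V) (hS : S.ModelsGBAC) :
    S.WeakVopenkaPrinciple ↔ S.SemiWeakVopenkaPrinciple := by
  constructor
  · intro hW
    rintro ⟨F, hF, hhom, hno⟩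
    have : Fact S.ModelsGBAC := ⟨hS⟩
    have : Nonempty V := ⟨hS.infinity.choose⟩
    obtain ⟨gr, hgr, hd⟩ := SecondOrderStructure.exists_isDescending hF hhom hno
    exact SecondOrderStructure.not_weakVopenkaPrinciple hd hW
  · rintro hW ⟨F, hF, hhom, hno⟩
    exact hW ⟨F, hF, fun α β hα hβ h Gα Gβ hGα hGβ => (hhom α β hα hβ h Gα Gβ hGα hGβ).exists, hno⟩
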